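/- Let $\lambda_p>0$, $d>0$ and $0<R_{\mathrm{tx}}<R_{\mathrm{cs}}$. Let $\Phi_{\rm PPP}=\{x_i\}$ be a homogeneous Poisson point process of intensity $\lambda_p$ on $\mathbb{R}^2$. Give each $x_i$ an orientation $\theta_i\in[0,2\pi]$ and a time mark $m_i$, where the $\theta_i$ are i.i.d. (for example uniform on $[0,2\pi]$), the $m_i$ are i.i.d. uniform on $[0,1]$, and locations, orientations and time marks are independent of one another. The exclusion region of a transmitter at $x$ with orientation $\theta$ is $$D(x,\theta)=B_x(R_{\mathrm{cs}})\cup B_{x+(d\cos\theta,\,d\sin\theta)}(R_{\mathrm{tx}}),$$ where $B_x(r)$ is the closed disk of radius $r$ around $x$. In the Type II dual-zone hard-core process, $(x_i,\theta_i,m_i)$ is retained if and only if $m_i<m_j$ for all $j\neq i$ with $x_j\in D(x_i,\theta_i)$; the set $\Phi$ of active transmitters consists of the locations $x_i$ of the retained nodes. Put $$V_o=(\pi-\xi_1)R_{\mathrm{cs}}^2+(\pi-\xi_2)R_{\mathrm{tx}}^2+d\,R_{\mathrm{cs}}\sin\xi_1,\qquad \xi_1=\arccos\frac{d^2+R_{\mathrm{cs}}^2-R_{\mathrm{tx}}^2}{2dR_{\mathrm{cs}}},\quad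 \xi_2=\arccos\frac{d^2+R_{\mathrm{tx}}^2-R_{\mathrm{cs}}^2}{2dR_{\mathrm{tx}}},$$ where $\arccos u$ is read as $0$ for $u>1$ and as $\pi$ for $u<-1$ (which happens when the two circles do not meet). Then $V_o>0$ is the area of every exclusion region $D(x,\theta)$, and $\Phi$ has intensity $$\lambda=\frac{1-e^{-\lambda_pV_o}}{V_o},$$ that is, $\mathbb{E}\,\#(\Phi\cap B)=\lambda|B|$ for every Borel set $B\subseteq\mathbb{R}^2$. Moreover $$\lambda=\lambda_p\,P_o(o\in\Phi)=\lambda_p\int_0^1 e^{-\lambda_p tV_o}\,\mathrm{d}t,$$ where $P_o$ is the Palm probability of the marked process with respect to the points of $\Phi_{\rm PPP}$, i.e. $P_o(Y)=(\lambda_p|B|)^{-1}\,\mathbb{E}\sum_{x_i\in B}\mathbf{1}\{\text{the marked process translated by }-x_i\text{ lies in }Y\}$ for any Borel $B$ with $0<|B|<\infty$. Here $e^{-\lambda_ptV_o}$ is the retention probability of a pair with time mark $t$: under $P_o$ the mark $m_o$ of the origin is uniform on $[0,1]$ and $P_o(o\in\Phi,\ m_o\in T)=\int_T e^{-\lambda_ptV_o}\,\mathrm{d}t$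 for every Borel $T\subseteq[0,1]$; and for every location $y$, orientation $\alpha$ and $t\in[0,1]$, a node $(y,\alpha,t)$ added to the marked Poisson process is retained with probability $e^{-\lambda_ptV_o}$. -/

import Mathlib

open MeasureTheory ProbabilityTheory Set
open scoped ENNReal NNReal

noncomputable section

namespace DZHCP

/-- The Euclidean plane. -/
abbrev Plane : Type := EuclideanSpace ℝ (Fin 2)

/-- A marked transmitter `(x, θ, m)`: location `x`, receiver orientation `θ`, time mark `m`. -/
abbrev Node : Type := Plane × ℝ × ℝ

/-- The receiver of a transmitter at `x`: at distance `d` in direction `θ`. -/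
def receiver (d : ℝ) (x : Plane) (θ : ℝ) : Plane :=
  x + !₂[d * Real.cos θ, d * Real.sin θ]

/-- The exclusion region of a transceiver pair: the disk of radius `Rcs` around the transmitter
together with the disk of radius `Rtx` around the receiver. -/
def exclusionRegion (d Rcs Rtx : ℝ) (x : Plane) (θ : ℝ) : Set Plane :=
  Metric.closedBall x Rcs ∪ Metric.closedBall (receiver d x θ) Rtx

def xi₁ (d Rcs Rtx : ℝ) : ℝ := Real.arccos ((d ^ 2 + Rcs ^ 2 - Rtx ^ 2) / (2 * d * Rcs))

def xi₂ (d Rcs Rtx : ℝ) : ℝ := Real.arccos ((d ^ 2 + Rtx ^ 2 - Rcs ^ 2) / (2 * d * Rtx))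

/-- The closed formula for the area `V_o` of the exclusion region. `Real.arccos` is `0` above `1`
and `π` below `-1`, so that the formula also gives the area of the union when the two circles do
not meet (disjoint or nested disks). -/
def Vo (d Rcs Rtx : ℝ) : ℝ :=
  (Real.pi - xi₁ d Rcs Rtx) * Rcs ^ 2 + (Real.pi - xi₂ d Rcs Rtx) * Rtx ^ 2
    + d * Rcs * Real.sin (xi₁ d Rcs Rtx)

/-- The neighbours of `p` in the marked configuration `ψ`: the other nodes of `ψ` whose transmitter
lies in the exclusion region of `p`. -/
def neighbours (d Rcs Rtx : ℝ) (ψ : Set Node) (p : Node) : Set Node :=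
  {q | q ∈ ψ ∧ q.1 ∈ exclusionRegion d Rcs Rtx p.1 p.2.1 ∧ q ≠ p}

/-- `p` is a node of `ψ` whose Type II medium access indicator equals `1`: its time mark is smaller
than the time marks of all its neighbours. -/
def Retained (d Rcs Rtx : ℝ) (ψ : Set Node) (p : Node) : Prop :=
  p ∈ ψ ∧ ∀ q ∈ neighbours d Rcs Rtx ψ p, p.2.2 < q.2.2

/-- The active transceiver pairs `(x, θ)` left by Type II thinning of `ψ`. -/
def activePairs (d Rcs Rtx : ℝ) (ψ : Set Node) : Set (Plane × ℝ) :=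
  (fun p : Node => (p.1, p.2.1)) '' {p | Retained d Rcs Rtx ψ p}

/-- The active transmitters left by Type II thinning of `ψ`. -/
def activeTransmitters (d Rcs Rtx : ℝ) (ψ : Set Node) : Set Plane :=
  Prod.fst '' activePairs d Rcs Rtx ψ

variable {Ω : Type*} [MeasurableSpace Ω]

/-- The random point set `Φ` is a homogeneous Poisson point process of intensity `lam` on the
plane: counts in sets of finite area are Poisson with mean `lam` times the area, and counts in
disjoint sets are independent. -/
structure IsPoissonProcess (P : Measure Ω) (lam : ℝ≥0) (Φ : Ω → Set Plane) : Prop where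
  count_law : ∀ A : Set Plane, MeasurableSet A → volume A < ∞ →
    HasLaw (fun ω => (Φ ω ∩ A).encard)
      ((poissonMeasure (lam * (volume A).toNNReal)).map (Nat.cast : ℕ → ℕ∞)) P
  count_indep : ∀ (n : ℕ) (A : Fin n → Set Plane), (∀ k, MeasurableSet (A k)) →
    Pairwise (fun k l => Disjoint (A k) (A l)) →
    iIndepFun (fun k ω => (Φ ω ∩ A k).encard) P

/-- The marked Poisson process of the Type II model, through an enumeration `(x i, θ i, m i)` of its
nodes: the (almost surely distinct) locations `x i` form a Poisson process of intensity `lam`; the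
orientations `θ i` are i.i.d. on `[0, 2π]`, the time marks `m i` are i.i.d. uniform on `[0, 1]`, and
locations, orientations and time marks are independent of one another. -/
structure IsMarkedPoisson (P : Measure Ω) (lam : ℝ≥0)
    (x : ℕ → Ω → Plane) (θ : ℕ → Ω → ℝ) (m : ℕ → Ω → ℝ) : Prop where
  measurable_x : ∀ i, Measurable (x i)
  measurable_θ : ∀ i, Measurable (θ i)
  measurable_m : ∀ i, Measurable (m i)
  distinct : ∀ᵐ ω ∂P, Function.Injective (fun i => x i ω)
  poisson : IsPoissonProcess P lam (fun ω => range (fun i => x i ω))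
  θ_mem : ∀ i, ∀ᵐ ω ∂P, θ i ω ∈ Icc 0 (2 * Real.pi)
  θ_ident : ∀ i j, IdentDistrib (θ i) (θ j) P P
  m_uniform : ∀ i, HasLaw (m i) (volume.restrict (Icc (0 : ℝ) 1)) P
  indep_θ_m : ∀ i, IndepFun (θ i) (m i) P
  indep_marks : iIndepFun (fun i ω => (θ i ω, m i ω)) P
  indep_locations : IndepFun (fun ω i => x i ω) (fun ω i => (θ i ω, m i ω)) P

/-- The random marked configuration with nodes `(x i, θ i, m i)`. -/
def config (x : ℕ → Ω → Plane) (θ : ℕ → Ω → ℝ) (m : ℕ → Ω → ℝ) (ω : Ω) : Set Node :=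
  range (fun i => ((x i ω, θ i ω, m i ω) : Node))

/-- The random point set `Φ` has intensity `lam`: the number of its points in a Borel set `B` is a
random variable with mean `lam` times the area of `B`. -/
def HasIntensity (P : Measure Ω) (Φ : Ω → Set Plane) (lam : ℝ) : Prop :=
  0 ≤ lam ∧ ∀ B : Set Plane, MeasurableSet B →
    AEMeasurable (fun ω => ((Φ ω ∩ B).encard : ℝ≥0∞)) P ∧
    ∫⁻ ω, ((Φ ω ∩ B).encard : ℝ≥0∞) ∂P = ENNReal.ofReal lam * volume B

/-- Translation of the locations of a marked configuration by `-y`; marks are kept. -/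
def recentre (y : Plane) (ψ : Set Node) : Set Node :=
  (fun p : Node => (p.1 - y, p.2)) '' ψ

/-- The Palm probability of a set `Y` of marked configurations, for a marked process `Ψ` with
intensity of locations `lam`, computed on the window `B`:
`(lam |B|)⁻¹ E ∑_{p ∈ Ψ, p.1 ∈ B} 1_Y (Ψ translated by -p.1)`. -/
def palmProb (P : Measure Ω) (lam : ℝ≥0) (Ψ : Ω → Set Node) (B : Set Plane)
    (Y : Set (Set Node)) : ℝ≥0∞ :=
  (∫⁻ ω, (({p | p ∈ Ψ ω ∧ p.1 ∈ B ∧ recentre p.1 (Ψ ω) ∈ Y} : Set Node).encard : ℝ≥0∞) ∂P)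
    / (lam * volume B)

/-- The event that the origin is an active transmitter. -/
def originActive (d Rcs Rtx : ℝ) : Set (Set Node) :=
  {ψ | (0 : Plane) ∈ activeTransmitters d Rcs Rtx ψ}

/-- The event that there is a node at the origin with time mark in `T`. -/
def originMark (T : Set ℝ) : Set (Set Node) :=
  {ψ | ∃ p ∈ ψ, p.1 = 0 ∧ p.2.2 ∈ T}

end DZHCP

end

/-! A node with time mark `t` is retained iff every other point in its exclusion region has a mark
above `t`. Given the locations and its own mark pair, this has probability `(1 - t) ^ N`, where `N`
is the number of those points. For a Poisson process the other points seen from a typical point are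
again Poisson (Mecke), so `N` is Poisson with mean `λ_p V_o`, and its generating function at `s = 1
- t` is `exp (-λ_p t V_o)`. The area does not depend on the orientation, so neither does this value.
Integrating over a uniform `t` gives the intensity.

The argument has three ingredients. `volume_exclusionRegion` computes the area by cutting the union
of two disks along their radical axis. `mecke` proves the needed case of the Mecke formula from the
count axioms alone: first for a neighbourhood that does not move with the point, where independence
of counts in `B` and `A \ B` suffices (`mecke_fixed`), then for a neighbourhood that depends only on
the cell of the point (`mecke_cells`), then in the limit of small cells. `measure_wins` integrates
out the marks at frozen locations.

`lintegral_wins` combines them into the expected number of retained nodes with location in `B` and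
mark in `T`. The intensity and the Palm statements about being active are readings of it; a node
added at a fixed place needs only the generating function (`measure_added_wins`). -/

noncomputable section

namespace DZHCP

open Filter Topology

/-! ### Area of the union of two disks. -/

section

/-- The area of the part of the disk of radius `R` around the origin to the left of the vertical
line at `a`. -/
def segmentArea (R a : ℝ) : ℝ :=
  R ^ 2 * (Real.pi - Real.arccos (a / R)) + a * √(R ^ 2 - a ^ 2)

lemma continuous_segmentArea (R : ℝ) : Continuous (segmentArea R) := by
  unfold segmentArea
  have := Real.continuous_arccos
  fun_prop

lemma segmentArea_of_le_neg {R a : ℝ} (hR : 0 < R) (ha : a ≤ -R) : segmentArea R a = 0 := by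
  have h1 : a / R ≤ -1 := by rw [div_le_iff₀ hR]; linarith
  have h2 : R ^ 2 - a ^ 2 ≤ 0 := by nlinarith
  simp [segmentArea, Real.arccos_of_le_neg_one h1, Real.sqrt_eq_zero_of_nonpos h2]

lemma segmentArea_of_le {R a : ℝ} (hR : 0 < R) (ha : R ≤ a) :
    segmentArea R a = R ^ 2 * Real.pi := by
  have h1 : 1 ≤ a / R := by rw [le_div_iff₀ hR]; linarith
  have h2 : R ^ 2 - a ^ 2 ≤ 0 := by nlinarith
  simp [segmentArea, Real.arccos_of_one_le h1, Real.sqrt_eq_zero_of_nonpos h2]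

/-- The derivative is the chord length at `x`. The points `±R`, where `arccos` is not
differentiable, are left out; beyond them the function is locally constant and the square root is
`0`. -/
lemma hasDerivAt_segmentArea {R x : ℝ} (hR : 0 < R) (h1 : x ≠ -R) (h2 : x ≠ R) :
    HasDerivAt (segmentArea R) (2 * √(R ^ 2 - x ^ 2)) x := by
  rcases lt_or_gt_of_ne h1 with h | h
  · have h0 : R ^ 2 - x ^ 2 ≤ 0 := by nlinarith
    rw [Real.sqrt_eq_zero_of_nonpos h0, mul_zero]
    refine (hasDerivAt_const x (0 : ℝ)).congr_of_eventuallyEq ?_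
    filter_upwards [Iio_mem_nhds h] with y hy using segmentArea_of_le_neg hR (le_of_lt hy)
  rcases lt_or_gt_of_ne h2 with h' | h'
  · have hpos : 0 < R ^ 2 - x ^ 2 := by nlinarith
    have hne1 : x / R ≠ -1 := fun h => h1 (by rw [div_eq_iff hR.ne'] at h; linarith)
    have hne2 : x / R ≠ 1 := fun h => h2 (by rw [div_eq_iff hR.ne'] at h; linarith)
    have hs : √(1 - (x / R) ^ 2) = √(R ^ 2 - x ^ 2) / R := by
      rw [eq_div_iff hR.ne', ← Real.sqrt_sq hR.le, ← Real.sqrt_mul' _ (sq_nonneg _),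
        Real.sqrt_sq hR.le]
      congr 1
      field_simp
    have hA := (Real.hasDerivAt_arccos hne1 hne2).comp x ((hasDerivAt_id x).div_const R)
    have hB : HasDerivAt (fun y => R ^ 2 - y ^ 2) (-(2 * x)) x := by
      simpa using ((hasDerivAt_pow 2 x).const_sub (R ^ 2))
    have hC := (hasDerivAt_id x).mul (hB.sqrt hpos.ne')
    have hD := ((hA.const_sub Real.pi).const_mul (R ^ 2)).add hC
    refine HasDerivAt.congr_deriv hD ?_
    have hsp := Real.sqrt_pos.2 hpos
    simp only [id]
    rw [hs]
    -- With `s = √(R ^ 2 - x ^ 2)` the `arccos` term contributes `R ^ 2 / s` and the product term `s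
    -- - x ^ 2 / s`; they add up to `2 * s`.
    have hsq := Real.sq_sqrt hpos.le
    field_simp
    nlinarith
  · have h0 : R ^ 2 - x ^ 2 ≤ 0 := by nlinarith
    rw [Real.sqrt_eq_zero_of_nonpos h0, mul_zero]
    refine (hasDerivAt_const x (R ^ 2 * Real.pi)).congr_of_eventuallyEq ?_
    filter_upwards [Ioi_mem_nhds h'] with y hy using segmentArea_of_le hR (le_of_lt hy)

lemma lintegral_chord {R : ℝ} (hR : 0 < R) (a : ℝ) :
    ∫⁻ x in Iic a, ENNReal.ofReal (2 * √(R ^ 2 - x ^ 2)) = ENNReal.ofReal (segmentArea R a) := by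
  -- A base point to the left of the disk: the integrand vanishes below it and the primitive is `0`
  -- there.
  set b : ℝ := min (-R) a with hb
  have hba : b ≤ a := min_le_right _ _
  have hbR : b ≤ -R := min_le_left _ _
  have hcont : Continuous fun x : ℝ => 2 * √(R ^ 2 - x ^ 2) := by fun_prop
  rw [← Iic_union_Ioc_eq_Iic hba, lintegral_union measurableSet_Ioc
    (Iic_disjoint_Ioc le_rfl)]
  have h0 : ∫⁻ x in Iic b, ENNReal.ofReal (2 * √(R ^ 2 - x ^ 2)) = 0 := by
    rw [setLIntegral_congr_fun (g := fun _ => 0) measurableSet_Iic, lintegral_zero]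
    intro x hx
    have hx' : x ≤ -R := le_trans hx hbR
    have : R ^ 2 - x ^ 2 ≤ 0 := by nlinarith
    simp [Real.sqrt_eq_zero_of_nonpos this]
  rw [h0, zero_add, ← ofReal_integral_eq_lintegral_ofReal
    (hcont.integrableOn_Icc.mono_set Ioc_subset_Icc_self)
    (Filter.Eventually.of_forall fun x => by positivity),
    ← intervalIntegral.integral_of_le hba,
    MeasureTheory.integral_eq_of_hasDerivAt_off_countable (segmentArea R) _
      ((Set.countable_singleton R).insert (-R)) (continuous_segmentArea R).continuousOn
      (fun x hx => hasDerivAt_segmentArea hR (fun h => hx.2 (by simp [h]))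
        (fun h => hx.2 (by simp [h]))) (hcont.intervalIntegrable _ _),
    segmentArea_of_le_neg hR hbR, sub_zero]

lemma volume_disk_slice (R : ℝ) {I : Set ℝ} (hI : MeasurableSet I) :
    volume {p : ℝ × ℝ | p.1 ^ 2 + p.2 ^ 2 ≤ R ^ 2 ∧ p.1 ∈ I} =
      ∫⁻ x in I, ENNReal.ofReal (2 * √(R ^ 2 - x ^ 2)) := by
  have hm : MeasurableSet {p : ℝ × ℝ | p.1 ^ 2 + p.2 ^ 2 ≤ R ^ 2 ∧ p.1 ∈ I} := by
    measurability
  rw [Measure.volume_eq_prod, Measure.prod_apply hm, ← lintegral_indicator hI]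
  refine lintegral_congr fun x => ?_
  by_cases hx : x ∈ I
  · rw [indicator_of_mem hx]
    rcases le_or_gt 0 (R ^ 2 - x ^ 2) with h | h
    · have : Prod.mk x ⁻¹' {p : ℝ × ℝ | p.1 ^ 2 + p.2 ^ 2 ≤ R ^ 2 ∧ p.1 ∈ I} =
          Icc (-√(R ^ 2 - x ^ 2)) √(R ^ 2 - x ^ 2) := by
        ext y
        simp only [mem_preimage, mem_ofPred_eq, hx, and_true, mem_Icc, ← abs_le]
        rw [← Real.sqrt_sq_eq_abs, Real.sqrt_le_sqrt_iff h]
        constructor <;> intro <;> linarith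
      rw [this, Real.volume_Icc]
      congr 1
      ring
    · have : Prod.mk x ⁻¹' {p : ℝ × ℝ | p.1 ^ 2 + p.2 ^ 2 ≤ R ^ 2 ∧ p.1 ∈ I} = ∅ := by
        ext y
        simp only [mem_preimage, mem_ofPred_eq, hx, and_true, mem_empty_iff_false, iff_false]
        nlinarith [sq_nonneg y]
      simp [this, Real.sqrt_eq_zero_of_nonpos h.le]
  · rw [indicator_of_notMem hx]
    have : Prod.mk x ⁻¹' {p : ℝ × ℝ | p.1 ^ 2 + p.2 ^ 2 ≤ R ^ 2 ∧ p.1 ∈ I} = ∅ := by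
      ext y; simp [hx]
    simp [this]

lemma segmentArea_nonneg {R : ℝ} (hR : 0 < R) (a : ℝ) : 0 ≤ segmentArea R a := by
  have hmono : Monotone (segmentArea R) := by
    have hc : Continuous fun x : ℝ => 2 * √(R ^ 2 - x ^ 2) := by fun_prop
    intro u v huv
    have := MeasureTheory.integral_eq_of_hasDerivAt_off_countable (a := u) (b := v)
      (segmentArea R) _ ((Set.countable_singleton R).insert (-R))
      (continuous_segmentArea R).continuousOn
      (fun x hx => hasDerivAt_segmentArea hR (fun h => hx.2 (by simp [h]))
        (fun h => hx.2 (by simp [h]))) (hc.intervalIntegrable _ _)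
    have h2 : 0 ≤ ∫ x in u..v, 2 * √(R ^ 2 - x ^ 2) :=
      intervalIntegral.integral_nonneg huv fun x _ => by positivity
    linarith
  rw [← segmentArea_of_le_neg hR (min_le_left (-R) a)]
  exact hmono (min_le_right _ _)

/-- On the radical axis, the vertical line at `a`, both circles have equal power. To its left the
second disk lies inside the first, to its right the first lies inside the second. Each half of the
union is therefore a segment of one disk, whether or not the circles meet. -/
lemma volume_two_disks {d R r : ℝ} (hd : 0 < d) (hR : 0 < R) (hr : 0 < r) :
    volume {p : ℝ × ℝ | p.1 ^ 2 + p.2 ^ 2 ≤ R ^ 2 ∨ (p.1 - d) ^ 2 + p.2 ^ 2 ≤ r ^ 2} =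
      ENNReal.ofReal (segmentArea R ((d ^ 2 + R ^ 2 - r ^ 2) / (2 * d)) +
        segmentArea r ((d ^ 2 + r ^ 2 - R ^ 2) / (2 * d))) := by
  set a := (d ^ 2 + R ^ 2 - r ^ 2) / (2 * d) with ha
  have hda : (d ^ 2 + r ^ 2 - R ^ 2) / (2 * d) = d - a := by rw [ha]; field_simp; ring
  have ha' : 2 * d * a = d ^ 2 + R ^ 2 - r ^ 2 := by rw [ha]; field_simp
  rw [hda, ENNReal.ofReal_add (segmentArea_nonneg hR _) (segmentArea_nonneg hr _),
    ← lintegral_chord hR, ← lintegral_chord hr, ← volume_disk_slice R measurableSet_Iic,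
    setLIntegral_congr Iio_ae_eq_Iic.symm, ← volume_disk_slice r measurableSet_Iio,
    ← measure_inter_add_sdiff _ (measurable_fst (measurableSet_Iic (a := a)))]
  congr 1
  · congr 1
    ext p
    simp only [mem_inter_iff, mem_ofPred_eq, mem_preimage, mem_Iic]
    constructor
    · rintro ⟨h | h, hp⟩
      · exact ⟨h, hp⟩
      · exact ⟨by nlinarith, hp⟩
    · rintro ⟨h, hp⟩
      exact ⟨Or.inl h, hp⟩
  · have hmp : MeasurePreserving (fun p : ℝ × ℝ => (d - p.1, p.2)) volume volume :=
      (Measure.measurePreserving_sub_left volume d).prod (MeasurePreserving.id volume)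
    have hm : MeasurableSet {p : ℝ × ℝ | p.1 ^ 2 + p.2 ^ 2 ≤ r ^ 2 ∧ p.1 ∈ Iio (d - a)} := by
      measurability
    rw [← hmp.measure_preimage hm.nullMeasurableSet]
    congr 1
    ext p
    simp only [Set.mem_sdiff, mem_ofPred_eq, mem_preimage, mem_Iic, mem_Iio, not_le]
    constructor
    · rintro ⟨h | h, hp⟩
      · exact ⟨by nlinarith, by linarith⟩
      · exact ⟨by nlinarith, by linarith⟩
    · rintro ⟨h, hp⟩
      exact ⟨Or.inr (by nlinarith), by linarith⟩

/-- Both segments end at the same half chord `h` (`e3`), so the triangle terms `a * h + (d - a) * h`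
collapse to `d * h`, and `h = Rcs * sin ξ₁` (`e4`). If the circles do not meet, both sides have `h =
0`. -/
lemma segmentArea_add_eq_Vo {d Rcs Rtx : ℝ} (hd : 0 < d) (hR : 0 < Rcs) :
    segmentArea Rcs ((d ^ 2 + Rcs ^ 2 - Rtx ^ 2) / (2 * d)) +
        segmentArea Rtx ((d ^ 2 + Rtx ^ 2 - Rcs ^ 2) / (2 * d)) = Vo d Rcs Rtx := by
  have e1 : (d ^ 2 + Rcs ^ 2 - Rtx ^ 2) / (2 * d) / Rcs =
      (d ^ 2 + Rcs ^ 2 - Rtx ^ 2) / (2 * d * Rcs) := by rw [div_div]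
  have e2 : (d ^ 2 + Rtx ^ 2 - Rcs ^ 2) / (2 * d) / Rtx =
      (d ^ 2 + Rtx ^ 2 - Rcs ^ 2) / (2 * d * Rtx) := by rw [div_div]
  have e3 : Rtx ^ 2 - ((d ^ 2 + Rtx ^ 2 - Rcs ^ 2) / (2 * d)) ^ 2 =
      Rcs ^ 2 - ((d ^ 2 + Rcs ^ 2 - Rtx ^ 2) / (2 * d)) ^ 2 := by field_simp; ring
  have e4 : Rcs * √(1 - ((d ^ 2 + Rcs ^ 2 - Rtx ^ 2) / (2 * d * Rcs)) ^ 2) =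
      √(Rcs ^ 2 - ((d ^ 2 + Rcs ^ 2 - Rtx ^ 2) / (2 * d)) ^ 2) := by
    rw [← e1]
    nth_rewrite 1 [← Real.sqrt_sq hR.le]
    rw [← Real.sqrt_mul (sq_nonneg _)]
    congr 1
    field_simp
  have e5 : (d ^ 2 + Rtx ^ 2 - Rcs ^ 2) / (2 * d) =
      d - (d ^ 2 + Rcs ^ 2 - Rtx ^ 2) / (2 * d) := by field_simp; ring
  unfold segmentArea Vo xi₁ xi₂
  rw [e1, e2, e3, Real.sin_arccos, mul_assoc d, e4, e5]
  ring

/-- Coordinates of the plane in the orthonormal frame whose first vector has direction `α`. -/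
def frame (α : ℝ) (q : Plane) : ℝ × ℝ :=
  (q 0 * Real.cos α + q 1 * Real.sin α, q 1 * Real.cos α - q 0 * Real.sin α)

/-- In complex coordinates `frame α` is the rotation by `-α`. -/
lemma measurePreserving_frame (α : ℝ) : MeasurePreserving (frame α) volume volume := by
  have h := Complex.volume_preserving_equiv_real_prod.comp
    ((rotation (Circle.exp (-α))).measurePreserving.comp
      Complex.orthonormalBasisOneI.measurePreserving_repr_symm)
  have hf : frame α = Complex.measurableEquivRealProd ∘ rotation (Circle.exp (-α)) ∘
      Complex.orthonormalBasisOneI.repr.symm := by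
    ext q
    · simp [frame, rotation_apply, Complex.exp_re, Complex.exp_im,
        Complex.measurableEquivRealProd_apply, -Circle.exp_neg, -rotation_symm, -map_neg]
      ring
    · simp [frame, rotation_apply, Complex.exp_re, Complex.exp_im,
        Complex.measurableEquivRealProd_apply, -Circle.exp_neg]
      ring
  rw [hf]
  exact h

lemma dist_sq_plane (p q : Plane) : dist p q ^ 2 = (p 0 - q 0) ^ 2 + (p 1 - q 1) ^ 2 := by
  rw [EuclideanSpace.dist_eq, Real.sq_sqrt (by positivity)]
  simp [Fin.sum_univ_two, Real.dist_eq, sq_abs]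

lemma mem_exclusionRegion_iff {d Rcs Rtx : ℝ} {y q : Plane} {α : ℝ} :
    q ∈ exclusionRegion d Rcs Rtx y α ↔ dist q y ≤ Rcs ∨ dist q (receiver d y α) ≤ Rtx := by
  simp [exclusionRegion]

lemma exclusionRegion_translate (d Rcs Rtx : ℝ) (y z q : Plane) (α : ℝ) :
    q - z ∈ exclusionRegion d Rcs Rtx (y - z) α ↔ q ∈ exclusionRegion d Rcs Rtx y α := by
  have : receiver d (y - z) α = receiver d y α - z := by simp only [receiver]; abel
  rw [mem_exclusionRegion_iff, mem_exclusionRegion_iff, this, dist_sub_right, dist_sub_right]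

lemma volume_exclusionRegion {d Rcs Rtx : ℝ} (hd : 0 < d) (hR : 0 < Rcs) (hr : 0 < Rtx)
    (y : Plane) (α : ℝ) :
    volume (exclusionRegion d Rcs Rtx y α) = ENNReal.ofReal (Vo d Rcs Rtx) := by
  have hm : MeasurableSet {p : ℝ × ℝ | p.1 ^ 2 + p.2 ^ 2 ≤ Rcs ^ 2 ∨
      (p.1 - d) ^ 2 + p.2 ^ 2 ≤ Rtx ^ 2} := by
    measurability
  have hmp := (measurePreserving_frame α).comp (measurePreserving_sub_right volume y)
  rw [← segmentArea_add_eq_Vo hd hR, ← volume_two_disks hd hR hr,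
    ← hmp.measure_preimage hm.nullMeasurableSet]
  congr 1
  ext q
  have hcs := Real.sin_sq_add_cos_sq α
  rw [mem_exclusionRegion_iff, mem_preimage, mem_ofPred_eq,
    ← sq_le_sq₀ dist_nonneg hR.le, ← sq_le_sq₀ dist_nonneg hr.le, dist_sq_plane, dist_sq_plane]
  have h1 : ((frame α ∘ fun q => q - y) q).1 ^ 2 + ((frame α ∘ fun q => q - y) q).2 ^ 2 =
      (q 0 - y 0) ^ 2 + (q 1 - y 1) ^ 2 := by
    simp only [frame, Function.comp, PiLp.sub_apply]
    linear_combination ((q 0 - y 0) ^ 2 + (q 1 - y 1) ^ 2) * hcs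
  have h2 : (((frame α ∘ fun q => q - y) q).1 - d) ^ 2 + ((frame α ∘ fun q => q - y) q).2 ^ 2 =
      (q 0 - receiver d y α 0) ^ 2 + (q 1 - receiver d y α 1) ^ 2 := by
    simp only [frame, receiver, Function.comp, PiLp.sub_apply, PiLp.add_apply,
      Matrix.cons_val_zero, Matrix.cons_val_one]
    linear_combination ((q 0 - y 0) ^ 2 + (q 1 - y 1) ^ 2 - d ^ 2) * hcs
  rw [h1, h2]

lemma Vo_pos {d Rcs Rtx : ℝ} (hd : 0 < d) (hR : 0 < Rcs) (hr : 0 < Rtx) : 0 < Vo d Rcs Rtx := by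
  rw [← ENNReal.ofReal_pos, ← volume_exclusionRegion hd hR hr 0 0]
  exact (Metric.measure_closedBall_pos volume (0 : Plane) hR).trans_le
    (measure_mono subset_union_left)

end

/-! ### Products over index sets and Poisson generating functions. -/

section

open Classical in
/-- The infinite product over `j ∈ J` of the constant factor `s`. -/
def weight (s : ℝ≥0∞) (J : Set ℕ) : ℝ≥0∞ :=
  ⨅ n : ℕ, ∏ j ∈ Finset.range n, if j ∈ J then s else 1

open Classical in
lemma prod_ite_eq_pow (s : ℝ≥0∞) (J : Set ℕ) (n : ℕ) :
    (∏ j ∈ Finset.range n, if j ∈ J then s else 1) =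
      s ^ ((Finset.range n).filter (· ∈ J)).card := by
  rw [Finset.prod_ite, Finset.prod_const, Finset.prod_const_one, mul_one]

lemma weight_le_one (s : ℝ≥0∞) (J : Set ℕ) : weight s J ≤ 1 :=
  (iInf_le _ 0).trans_eq (by simp)

lemma weight_of_finite {s : ℝ≥0∞} (hs : s ≤ 1) {J : Set ℕ} (hJ : J.Finite) :
    weight s J = s ^ J.ncard := by
  classical
  have hcard (n : ℕ) : ((Finset.range n).filter (· ∈ J)).card ≤ J.ncard := by
    rw [← Set.ncard_coe_finset]
    exact Set.ncard_le_ncard (fun j hj => by simpa using (Finset.mem_filter.1 hj).2) hJ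
  refine le_antisymm ?_ (le_iInf fun n => ?_)
  · obtain ⟨n, hn⟩ := hJ.bddAbove
    refine (iInf_le _ (n + 1)).trans_eq ?_
    rw [prod_ite_eq_pow, ← Set.ncard_coe_finset]
    congr 2
    ext j
    simp only [Finset.coe_filter, Finset.mem_range, mem_ofPred_eq, and_iff_right_iff_imp]
    exact fun hj => Nat.lt_succ_of_le (hn hj)
  · convert pow_le_pow_right_of_le_one' hs (hcard n) using 1
    convert prod_ite_eq_pow s J n

lemma weight_one (J : Set ℕ) : weight 1 J = 1 := by
  simp [weight]

lemma measurable_weight {β : Type*} [MeasurableSpace β] {s : β → ℝ≥0∞} {J : β → Set ℕ}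
    (hs : Measurable s) (hJ : ∀ j, MeasurableSet {b | j ∈ J b}) :
    Measurable fun b => weight (s b) (J b) := by
  unfold weight
  refine Measurable.iInf fun n => Finset.measurable_fun_prod _ fun j _ => ?_
  exact Measurable.ite (hJ j) hs measurable_const

lemma lintegral_poissonMeasure (r : ℝ≥0) (g : ℕ → ℝ≥0∞) :
    ∫⁻ n, g n ∂poissonMeasure r =
      ∑' n, ENNReal.ofReal (Real.exp (-r) * r ^ n / n.factorial) * g n := by
  rw [poissonMeasure, lintegral_sum_measure]
  simp

lemma lintegral_pow_poissonMeasure (r : ℝ≥0) {s : ℝ} (hs : 0 ≤ s) :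
    ∫⁻ n, ENNReal.ofReal s ^ n ∂poissonMeasure r = ENNReal.ofReal (Real.exp (-(r * (1 - s)))) := by
  have h := (NormedSpace.expSeries_div_hasSum_exp ((r : ℝ) * s)).mul_left (Real.exp (-r))
  rw [← Real.exp_eq_exp_ℝ, ← Real.exp_add] at h
  rw [lintegral_poissonMeasure, show -((r : ℝ) * (1 - s)) = -r + r * s by ring, ← h.tsum_eq,
    ENNReal.ofReal_tsum_of_nonneg (fun n => by positivity) h.summable]
  refine tsum_congr fun n => ?_
  rw [← ENNReal.ofReal_pow hs, ← ENNReal.ofReal_mul (by positivity)]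
  congr 1
  rw [mul_pow]
  ring

/-- The derivative in `s` of the generating function, obtained by shifting the index of the series.
The truncated exponent at `n = 0` is harmless, since the factor `n` vanishes. -/
lemma lintegral_mul_pow_poissonMeasure (r : ℝ≥0) {s : ℝ} (hs : 0 ≤ s) :
    ∫⁻ n, (n : ℝ≥0∞) * ENNReal.ofReal s ^ (n - 1) ∂poissonMeasure r =
      r * ENNReal.ofReal (Real.exp (-(r * (1 - s)))) := by
  rw [← lintegral_pow_poissonMeasure r hs, lintegral_poissonMeasure, lintegral_poissonMeasure,
    tsum_eq_zero_add' ENNReal.summable, ← ENNReal.tsum_mul_left]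
  simp only [Nat.cast_zero, zero_mul, mul_zero, zero_add, Nat.add_sub_cancel]
  refine tsum_congr fun n => ?_
  rw [← mul_assoc, ← mul_assoc]
  congr 1
  rw [← ENNReal.ofReal_natCast, ← ENNReal.ofReal_mul (by positivity), ← ENNReal.ofReal_coe_nnreal,
    ← ENNReal.ofReal_mul (by positivity)]
  congr 1
  rw [Nat.factorial_succ]
  push_cast
  field_simp
  ring

variable {Ω : Type*} [MeasurableSpace Ω] {P : Measure Ω} {lam : ℝ≥0} {Φ : Ω → Set Plane}

lemma IsPoissonProcess.lintegral_comp (hΦ : IsPoissonProcess P lam Φ) {A : Set Plane}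
    (hA : MeasurableSet A) (hA' : volume A < ∞) (g : ℕ∞ → ℝ≥0∞) :
    ∫⁻ ω, g (Φ ω ∩ A).encard ∂P = ∫⁻ n : ℕ, g n ∂poissonMeasure (lam * (volume A).toNNReal) := by
  rw [(hΦ.count_law A hA hA').lintegral_comp (f := g) (Measurable.of_discrete.aemeasurable),
    lintegral_map .of_discrete .of_discrete]

lemma IsPoissonProcess.ae_finite (hΦ : IsPoissonProcess P lam Φ) {A : Set Plane}
    (hA : MeasurableSet A) (hA' : volume A < ∞) : ∀ᵐ ω ∂P, (Φ ω ∩ A).Finite := by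
  have h := (hΦ.count_law A hA hA').ae_iff (p := fun k => k ≠ ⊤) .of_discrete
  have h2 : ∀ᵐ k ∂((poissonMeasure (lam * (volume A).toNNReal)).map (Nat.cast : ℕ → ℕ∞)),
      k ≠ ⊤ := by
    rw [ae_map_iff Measurable.of_discrete.aemeasurable .of_discrete]
    exact Filter.Eventually.of_forall fun n => ENat.natCast_ne_top n
  filter_upwards [h.2 h2] with ω hω using Set.encard_ne_top_iff.1 hω

lemma IsPoissonProcess.lintegral_pow (hΦ : IsPoissonProcess P lam Φ) {A : Set Plane}
    (hA : MeasurableSet A) (hA' : volume A < ∞) {s : ℝ} (hs : 0 ≤ s) :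
    ∫⁻ ω, ENNReal.ofReal s ^ (Φ ω ∩ A).encard.toNat ∂P =
      ENNReal.ofReal (Real.exp (-(lam * (volume A).toReal * (1 - s)))) := by
  rw [hΦ.lintegral_comp hA hA' (fun k => ENNReal.ofReal s ^ k.toNat)]
  simpa [ENNReal.coe_toNNReal_eq_toReal] using
    lintegral_pow_poissonMeasure (lam * (volume A).toNNReal) hs

lemma IsPoissonProcess.lintegral_mul_pow (hΦ : IsPoissonProcess P lam Φ) {A : Set Plane}
    (hA : MeasurableSet A) (hA' : volume A < ∞) {s : ℝ} (hs : 0 ≤ s) :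
    ∫⁻ ω, ((Φ ω ∩ A).encard.toNat : ℝ≥0∞) *
        ENNReal.ofReal s ^ ((Φ ω ∩ A).encard.toNat - 1) ∂P =
      lam * volume A * ENNReal.ofReal (Real.exp (-(lam * (volume A).toReal * (1 - s)))) := by
  rw [hΦ.lintegral_comp hA hA' (fun k => (k.toNat : ℝ≥0∞) * ENNReal.ofReal s ^ (k.toNat - 1))]
  have := lintegral_mul_pow_poissonMeasure (lam * (volume A).toNNReal) hs
  simpa [ENNReal.coe_toNNReal hA'.ne, ENNReal.coe_toNNReal_eq_toReal] using this

end

/-! ### The Mecke formula for neighbourhoods constant on cells. -/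

section

lemma tsum_indicator_eq_encard {ξ : ℕ → Plane} (hξ : Function.Injective ξ) (B : Set Plane) :
    ∑' i, B.indicator (1 : Plane → ℝ≥0∞) (ξ i) = ((range ξ ∩ B).encard : ℝ≥0∞) := by
  rw [← image_preimage_eq_range_inter, hξ.encard_image, ← ENNReal.tsum_set_one,
    tsum_subtype (ξ ⁻¹' B) (fun _ => (1 : ℝ≥0∞))]
  rfl

/-- The right side does not depend on `i`: each point of `B` sees all points of `B` but itself, and
all points of `A \ B`. Summing over the points of `B` thus only multiplies by their number. -/
lemma weight_neighbours {ξ : ℕ → Plane} (hξ : Function.Injective ξ) {A B : Set Plane}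
    (hBA : B ⊆ A) (hB : (range ξ ∩ B).Finite) (hA : (range ξ ∩ (A \ B)).Finite)
    {s : ℝ≥0∞} (hs : s ≤ 1) {i : ℕ} (hi : ξ i ∈ B) :
    weight s {j | j ≠ i ∧ ξ j ∈ A} = s ^ ((range ξ ∩ B).encard.toNat - 1) *
      s ^ (range ξ ∩ (A \ B)).encard.toNat := by
  rw [← image_preimage_eq_range_inter] at hB hA ⊢
  rw [← image_preimage_eq_range_inter, hξ.encard_image, hξ.encard_image]
  have hB' := hB.of_finite_image hξ.injOn
  have hA' := hA.of_finite_image hξ.injOn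
  have hset : {j | j ≠ i ∧ ξ j ∈ A} = (ξ ⁻¹' B \ {i}) ∪ ξ ⁻¹' (A \ B) := by
    ext j
    simp only [mem_ofPred_eq, mem_union, Set.mem_sdiff, mem_preimage, mem_singleton_iff]
    constructor
    · rintro ⟨h1, h2⟩
      by_cases h : ξ j ∈ B
      · exact Or.inl ⟨h, h1⟩
      · exact Or.inr ⟨h2, h⟩
    · rintro (⟨h1, h2⟩ | ⟨h1, h2⟩)
      · exact ⟨h2, hBA h1⟩
      · exact ⟨fun h => h2 (h ▸ hi), h1⟩
  rw [hset, weight_of_finite hs (hB'.sdiff.union hA'), Set.ncard_union_eq _ hB'.sdiff hA',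
    Set.ncard_sdiff_singleton_of_mem (show i ∈ ξ ⁻¹' B from hi), pow_add]
  · rfl
  · exact Set.disjoint_left.2 fun j h1 h2 => h2.2 h1.1

variable {Ω : Type*} [MeasurableSpace Ω] {P : Measure Ω} {lam : ℝ≥0} {x : ℕ → Ω → Plane}

/-- With independent Poisson counts `N` in `B` and `N'` in `A \ B`, the left side is `E[N s ^ (N -
1)] E[s ^ N']`, and the two exponentials multiply to the one for `A`. -/
lemma mecke_fixed [IsProbabilityMeasure P] (hinj : ∀ᵐ ω ∂P, Function.Injective fun i => x i ω)
    (hΦ : IsPoissonProcess P lam fun ω => range fun i => x i ω)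
    {A B : Set Plane} (hA : MeasurableSet A) (hB : MeasurableSet B) (hBA : B ⊆ A)
    (hA' : volume A < ∞) {s : ℝ} (hs0 : 0 ≤ s) (hs1 : s ≤ 1) :
    ∫⁻ ω, ∑' i, B.indicator 1 (x i ω) *
        weight (ENNReal.ofReal s) {j | j ≠ i ∧ x j ω ∈ A} ∂P =
      lam * volume B * ENNReal.ofReal (Real.exp (-(lam * (volume A).toReal * (1 - s)))) := by
  have hs : ENNReal.ofReal s ≤ 1 := ENNReal.ofReal_le_one.2 hs1
  have hB' : volume B < ∞ := (measure_mono hBA).trans_lt hA'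
  have hD' : volume (A \ B) < ∞ := (measure_mono sdiff_subset).trans_lt hA'
  have hD := hA.diff hB
  have hind : IndepFun (fun ω => ((range fun i => x i ω) ∩ B).encard)
      (fun ω => ((range fun i => x i ω) ∩ (A \ B)).encard) P := by
    have hAB : Pairwise fun k l : Fin 2 => Disjoint (![B, A \ B] k) (![B, A \ B] l) := by
      simp [Pairwise, Fin.forall_fin_two, disjoint_sdiff_left, disjoint_sdiff_right]
    have h := hΦ.count_indep 2 ![B, A \ B] (Fin.forall_fin_two.2 ⟨hB, hD⟩) hAB
    simpa using h.indepFun (zero_ne_one (α := Fin 2))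
  calc
    _ = ∫⁻ ω, (((range fun i => x i ω) ∩ B).encard.toNat : ℝ≥0∞) *
          ENNReal.ofReal s ^ (((range fun i => x i ω) ∩ B).encard.toNat - 1) *
          ENNReal.ofReal s ^ ((range fun i => x i ω) ∩ (A \ B)).encard.toNat ∂P := by
      refine lintegral_congr_ae ?_
      filter_upwards [hinj, hΦ.ae_finite hB hB', hΦ.ae_finite hD hD'] with ω h1 h2 h3
      have h4 (i : ℕ) : B.indicator (1 : Plane → ℝ≥0∞) (x i ω) *
          weight (ENNReal.ofReal s) {j | j ≠ i ∧ x j ω ∈ A} = B.indicator 1 (x i ω) *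
          (ENNReal.ofReal s ^ (((range fun i => x i ω) ∩ B).encard.toNat - 1) *
          ENNReal.ofReal s ^ ((range fun i => x i ω) ∩ (A \ B)).encard.toNat) := by
        by_cases hi : x i ω ∈ B
        · rw [weight_neighbours (ξ := fun i => x i ω) h1 hBA h2 h3 hs hi]
        · simp [hi]
      simp_rw [h4]
      rw [ENNReal.tsum_mul_right, tsum_indicator_eq_encard (ξ := fun i => x i ω) h1, mul_assoc]
      congr 1
      conv_lhs => rw [← ENat.natCast_toNat (Set.encard_ne_top_iff.2 h2)]
      simp
    _ = _ := by
      have := lintegral_mul_eq_lintegral_mul_lintegral_of_indepFun''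
        (μ := P) (f := fun ω => (((range fun i => x i ω) ∩ B).encard.toNat : ℝ≥0∞) *
          ENNReal.ofReal s ^ (((range fun i => x i ω) ∩ B).encard.toNat - 1))
        (g := fun ω => ENNReal.ofReal s ^ ((range fun i => x i ω) ∩ (A \ B)).encard.toNat)
        (Measurable.of_discrete (f := fun k : ℕ∞ => (k.toNat : ℝ≥0∞) *
          ENNReal.ofReal s ^ (k.toNat - 1)) |>.comp_aemeasurable
            (hΦ.count_law B hB hB').aemeasurable)
        (Measurable.of_discrete (f := fun k : ℕ∞ => ENNReal.ofReal s ^ k.toNat)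
          |>.comp_aemeasurable (hΦ.count_law _ hD hD').aemeasurable)
        (hind.comp (φ := fun k : ℕ∞ => (k.toNat : ℝ≥0∞) * ENNReal.ofReal s ^ (k.toNat - 1))
          (ψ := fun k : ℕ∞ => ENNReal.ofReal s ^ k.toNat) .of_discrete .of_discrete)
      rw [this, hΦ.lintegral_mul_pow hB hB' hs0, hΦ.lintegral_pow hD hD' hs0, mul_assoc,
        ← ENNReal.ofReal_mul (Real.exp_pos _).le, ← Real.exp_add,
        ← measure_inter_add_sdiff A hB, inter_eq_self_of_subset_right hBA,
        ENNReal.toReal_add hB'.ne hD'.ne]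
      congr 3
      ring

lemma lintegral_tsum_indicator [IsProbabilityMeasure P]
    (hinj : ∀ᵐ ω ∂P, Function.Injective fun i => x i ω)
    (hΦ : IsPoissonProcess P lam fun ω => range fun i => x i ω)
    {B : Set Plane} (hB : MeasurableSet B) (hB' : volume B < ∞) :
    ∫⁻ ω, ∑' i, B.indicator (1 : Plane → ℝ≥0∞) (x i ω) ∂P = lam * volume B := by
  simpa [weight_one] using mecke_fixed hinj hΦ hB hB subset_rfl hB' zero_le_one le_rfl

lemma ae_locallyFinite (hinj : ∀ᵐ ω ∂P, Function.Injective fun i => x i ω)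
    (hΦ : IsPoissonProcess P lam fun ω => range fun i => x i ω) :
    ∀ᵐ ω ∂P, ∀ S : Set Plane, Bornology.IsBounded S → {j | x j ω ∈ S}.Finite := by
  have h : ∀ᵐ ω ∂P, ∀ n : ℕ,
      ((range fun i => x i ω) ∩ Metric.closedBall (0 : Plane) n).Finite :=
    ae_all_iff.2 fun n => hΦ.ae_finite Metric.isClosed_closedBall.measurableSet
      measure_closedBall_lt_top
  filter_upwards [hinj, h] with ω h1 h2 S hS
  obtain ⟨r, hr⟩ := hS.subset_closedBall (0 : Plane)
  obtain ⟨n, hn⟩ := exists_nat_ge r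
  have h3 := h2 n
  rw [← image_preimage_eq_range_inter] at h3
  exact (h3.of_finite_image h1.injOn).subset fun j hj =>
    Metric.closedBall_subset_closedBall hn (hr hj)

lemma exists_measurable_nat_approx (ε : ℝ) (hε : 0 < ε) :
    ∃ k : Plane → ℕ, Measurable k ∧ ∀ z, dist z (TopologicalSpace.denseSeq Plane (k z)) < ε := by
  classical
  have h (z : Plane) : ∃ n, dist z (TopologicalSpace.denseSeq Plane n) < ε :=
    (TopologicalSpace.denseRange_denseSeq Plane).exists_dist_lt z hε
  exact ⟨fun z => Nat.find (h z),
    measurable_find h fun n => measurableSet_lt (by fun_prop) (by fun_prop),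
    fun z => Nat.find_spec (h z)⟩

/-- The neighbourhood `D + e (k z)` is constant on each cell of `k`, and `hkD` says that it contains
the cell. So `mecke_fixed` applies cell by cell, with the same exponential each time. -/
lemma mecke_cells [IsProbabilityMeasure P] (hinj : ∀ᵐ ω ∂P, Function.Injective fun i => x i ω)
    (hx : ∀ i, Measurable (x i))
    (hΦ : IsPoissonProcess P lam fun ω => range fun i => x i ω)
    {k : Plane → ℕ} (hk : Measurable k) {e : ℕ → Plane} {D B : Set Plane} (hD : MeasurableSet D)
    (hD' : volume D < ∞) (hB : MeasurableSet B) (hkD : ∀ z, z - e (k z) ∈ D)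
    {s : ℝ} (hs0 : 0 ≤ s) (hs1 : s ≤ 1) :
    ∫⁻ ω, ∑' i, B.indicator 1 (x i ω) *
        weight (ENNReal.ofReal s) {j | j ≠ i ∧ x j ω - e (k (x i ω)) ∈ D} ∂P =
      lam * volume B * ENNReal.ofReal (Real.exp (-(lam * (volume D).toReal * (1 - s)))) := by
  have hcell (n : ℕ) : MeasurableSet (B ∩ k ⁻¹' {n}) := hB.inter (hk (measurableSet_singleton n))
  have htr (n : ℕ) : volume ((fun z => z - e n) ⁻¹' D) = volume D :=
    (measurePreserving_sub_right volume (e n)).measure_preimage hD.nullMeasurableSet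
  have hmeas (i : ℕ) (n : ℕ) : Measurable fun ω => (B ∩ k ⁻¹' {n}).indicator (1 : Plane → ℝ≥0∞)
      (x i ω) * weight (ENNReal.ofReal s) {j | j ≠ i ∧ x j ω ∈ (fun z => z - e n) ⁻¹' D} := by
    refine ((measurable_one.indicator (hcell n)).comp (hx i)).mul
      (measurable_weight measurable_const fun j => ?_)
    exact (MeasurableSet.const _).inter (hx j ((measurable_sub_const _) hD))
  have hsplit (ω : Ω) : (∑' i, B.indicator 1 (x i ω) *
        weight (ENNReal.ofReal s) {j | j ≠ i ∧ x j ω - e (k (x i ω)) ∈ D}) =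
      ∑' n, ∑' i, (B ∩ k ⁻¹' {n}).indicator 1 (x i ω) *
        weight (ENNReal.ofReal s) {j | j ≠ i ∧ x j ω ∈ (fun z => z - e n) ⁻¹' D} := by
    rw [ENNReal.tsum_comm]
    refine tsum_congr fun i => ?_
    rw [tsum_eq_single (k (x i ω))]
    · by_cases h : x i ω ∈ B <;> simp [h]
    · intro n hn
      rw [indicator_of_notMem, zero_mul]
      exact fun h => hn h.2.symm
  simp_rw [hsplit]
  rw [lintegral_tsum fun n => (Measurable.tsum fun i => hmeas i n).aemeasurable]
  have hfix (n : ℕ) := mecke_fixed hinj hΦ (A := (fun z => z - e n) ⁻¹' D)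
    (measurable_sub_const _ hD) (hcell n)
    (by rintro z ⟨-, rfl⟩; exact hkD z) (by rw [htr]; exact hD') hs0 hs1
  simp_rw [hfix, htr]
  rw [ENNReal.tsum_mul_right, ENNReal.tsum_mul_left, ← measure_iUnion _ hcell, ← inter_iUnion]
  · congr 3
    rw [inter_eq_left]
    exact fun z _ => mem_iUnion.2 ⟨k z, rfl⟩
  · intro m n hmn
    exact Set.disjoint_left.2 fun z h1 h2 => hmn (h1.2.symm.trans h2.2)

end

/-! ### The Mecke formula for translates of a compact set. -/

section

variable {Ω : Type*} [MeasurableSpace Ω] {P : Measure Ω} {lam : ℝ≥0} {x : ℕ → Ω → Plane}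

lemma mem_cthickening_iff_infDist_le {D : Set Plane} (hne : D.Nonempty) {δ : ℝ} (hδ : 0 ≤ δ)
    {z : Plane} : z ∈ Metric.cthickening δ D ↔ Metric.infDist z D ≤ δ := by
  rw [Metric.mem_cthickening_iff, Metric.infDist,
    ENNReal.le_ofReal_iff_toReal_le (Metric.infEDist_ne_top hne) hδ]

/-- The thickening absorbs the error in the centre, so no point is lost; since `D` is closed, each
point outside is eventually excluded. Local finiteness makes this uniform in `j`. -/
lemma eventually_mem_iff {D : Set Plane} (hD : IsCompact D) (hne : D.Nonempty) {ξ : ℕ → Plane}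
    (hξ : ∀ S : Set Plane, Bornology.IsBounded S → {j | ξ j ∈ S}.Finite) (z : Plane)
    {a : ℕ → Plane} (ha : ∀ n : ℕ, dist z (a n) < 1 / ((n : ℝ) + 1)) :
    ∀ᶠ n : ℕ in atTop, ∀ j,
      (ξ j - a n ∈ Metric.cthickening (1 / ((n : ℝ) + 1)) D ↔ ξ j - z ∈ D) := by
  have hpos (n : ℕ) : 0 < 1 / ((n : ℝ) + 1) := by positivity
  have hdist (n j : ℕ) : dist (ξ j - z) (ξ j - a n) < 1 / ((n : ℝ) + 1) := by
    rw [dist_sub_left]; exact ha n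
  -- All errors are at most `2 / (n + 1) ≤ 2`, so points outside this bounded set are never in
  -- question.
  have hfin : {j | ξ j ∈ (fun w => w + z) '' Metric.cthickening 2 D}.Finite := by
    refine hξ _ ?_
    exact ((hD.cthickening (r := 2)).image (by fun_prop)).isBounded
  have h1 (n j : ℕ) (h : ξ j - z ∈ D) : ξ j - a n ∈ Metric.cthickening (1 / ((n : ℝ) + 1)) D :=
    Metric.mem_cthickening_of_dist_le _ _ _ _ h (by rw [dist_comm]; exact (hdist n j).le)
  have h2 (n j : ℕ) (h : ξ j - a n ∈ Metric.cthickening (1 / ((n : ℝ) + 1)) D) :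
      Metric.infDist (ξ j - z) D ≤ 2 / ((n : ℝ) + 1) := by
    have h3 := (mem_cthickening_iff_infDist_le hne (hpos n).le).1 h
    have h4 := Metric.infDist_le_infDist_add_dist (s := D) (x := ξ j - z) (y := ξ j - a n)
    have h5 := hdist n j
    have h6 : 2 / ((n : ℝ) + 1) = 1 / ((n : ℝ) + 1) + 1 / ((n : ℝ) + 1) := by ring
    linarith
  have hev (j : ℕ) : ∀ᶠ n : ℕ in atTop,
      (ξ j - a n ∈ Metric.cthickening (1 / ((n : ℝ) + 1)) D ↔ ξ j - z ∈ D) := by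
    by_cases h : ξ j - z ∈ D
    · exact Eventually.of_forall fun n => iff_of_true (h1 n j h) h
    · have h3 : 0 < Metric.infDist (ξ j - z) D :=
        (hD.isClosed.notMem_iff_infDist_pos hne).1 h
      have h4 : Tendsto (fun n : ℕ => 2 / ((n : ℝ) + 1)) atTop (𝓝 0) := by
        have := (tendsto_one_div_add_atTop_nhds_zero_nat (𝕜 := ℝ)).const_mul 2
        simpa [div_eq_mul_inv] using this
      filter_upwards [h4.eventually (gt_mem_nhds h3)] with n hn
      exact iff_of_false (fun h5 => absurd (h2 n j h5) (not_le.2 hn)) h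
  filter_upwards [(hfin.eventually_all).2 fun j _ => hev j] with n hn j
  by_cases hj : ξ j ∈ (fun w => w + z) '' Metric.cthickening 2 D
  · exact hn j hj
  · have h3 : ¬ Metric.infDist (ξ j - z) D ≤ 2 := fun h =>
      hj ⟨ξ j - z, (mem_cthickening_iff_infDist_le hne zero_le_two).2 h, by simp⟩
    refine iff_of_false (fun h => h3 ((h2 n j h).trans ?_)) (fun h => h3 ?_)
    · rw [div_le_iff₀ (by positivity)]
      linarith [(Nat.cast_nonneg n : (0 : ℝ) ≤ n)]
    · rw [Metric.infDist_zero_of_mem h]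
      exact zero_le_two

/-- The Mecke formula of a Poisson process for the product over the other points in the translate
`D + x` of a factor `s`. -/
lemma mecke [IsProbabilityMeasure P] (hinj : ∀ᵐ ω ∂P, Function.Injective fun i => x i ω)
    (hx : ∀ i, Measurable (x i))
    (hΦ : IsPoissonProcess P lam fun ω => range fun i => x i ω)
    {D B : Set Plane} (hD : IsCompact D) (h0 : (0 : Plane) ∈ D) (hB : MeasurableSet B)
    (hB' : volume B < ∞) {s : ℝ} (hs0 : 0 ≤ s) (hs1 : s ≤ 1) :
    ∫⁻ ω, ∑' i, B.indicator 1 (x i ω) *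
        weight (ENNReal.ofReal s) {j | j ≠ i ∧ x j ω - x i ω ∈ D} ∂P =
      lam * volume B * ENNReal.ofReal (Real.exp (-(lam * (volume D).toReal * (1 - s)))) := by
  have hpos (n : ℕ) : 0 < 1 / ((n : ℝ) + 1) := by positivity
  -- Centres are rounded to a dense sequence within `1 / (n + 1)`, and `D` is thickened by the same
  -- amount; as `0 ∈ D`, each cell then lies in its neighbourhood.
  choose k hk hkd using fun n : ℕ => exists_measurable_nat_approx _ (hpos n)
  set e := TopologicalSpace.denseSeq Plane with he
  have hDn (n : ℕ) : MeasurableSet (Metric.cthickening (1 / ((n : ℝ) + 1)) D) :=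
    Metric.isClosed_cthickening.measurableSet
  have hDfin (n : ℕ) : volume (Metric.cthickening (1 / ((n : ℝ) + 1)) D) < ∞ :=
    hD.cthickening.measure_lt_top
  have hcells (n : ℕ) := mecke_cells hinj hx hΦ (hk n) (e := e) (hDn n) (hDfin n) hB
    (fun z => Metric.mem_cthickening_of_dist_le _ 0 _ _ h0
      (by rw [dist_zero_right, ← dist_eq_norm]; exact (hkd n z).le)) hs0 hs1
  have hlim1 : Tendsto (fun n : ℕ => lam * volume B * ENNReal.ofReal (Real.exp
      (-(lam * (volume (Metric.cthickening (1 / ((n : ℝ) + 1)) D)).toReal * (1 - s))))) atTop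
      (𝓝 (lam * volume B * ENNReal.ofReal (Real.exp (-(lam * (volume D).toReal * (1 - s)))))) := by
    refine ENNReal.Tendsto.const_mul ?_ (Or.inr (ENNReal.mul_ne_top ENNReal.coe_ne_top hB'.ne))
    have h1 := (tendsto_measure_cthickening_of_isCompact (μ := (volume : Measure Plane)) hD).comp
      (tendsto_one_div_add_atTop_nhds_zero_nat (𝕜 := ℝ))
    have h2 := (ENNReal.tendsto_toReal hD.measure_lt_top.ne).comp h1
    exact ENNReal.tendsto_ofReal ((Real.continuous_exp.tendsto _).comp
      (((h2.const_mul (lam : ℝ)).mul_const (1 - s)).neg))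
  simp_rw [← hcells] at hlim1
  -- The integrands are almost surely eventually constant in `n` and dominated by the number of
  -- points in `B`, which has mean `lam * volume B`.
  refine tendsto_nhds_unique (tendsto_lintegral_of_dominated_convergence
    (fun ω => ∑' i, B.indicator 1 (x i ω)) (fun n => ?_) (fun n => ?_) ?_ ?_) hlim1
  · refine Measurable.tsum fun i => ((measurable_one.indicator hB).comp (hx i)).mul
      (measurable_weight measurable_const fun j => ?_)
    refine (MeasurableSet.const _).inter (((hx j).sub (?_)) (hDn n))
    exact (Measurable.of_discrete (f := e)).comp ((hk n).comp (hx i))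
  · exact Eventually.of_forall fun ω => ENNReal.tsum_le_tsum fun i =>
      mul_le_of_le_one_right' (weight_le_one _ _)
  · rw [lintegral_tsum_indicator hinj hΦ hB hB']
    exact ENNReal.mul_ne_top ENNReal.coe_ne_top hB'.ne
  · have hBfin : ∀ᵐ ω ∂P, ((range fun i => x i ω) ∩ B).Finite := hΦ.ae_finite hB hB'
    filter_upwards [hinj, ae_locallyFinite hinj hΦ, hBfin] with ω hω1 hω2 hω3
    rw [← image_preimage_eq_range_inter] at hω3
    have hI := hω3.of_finite_image hω1.injOn
    refine tendsto_const_nhds.congr' ?_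
    filter_upwards [(hI.eventually_all).2 fun i _ => eventually_mem_iff hD ⟨0, h0⟩ hω2 (x i ω)
      (a := fun n => e (k n (x i ω))) fun n => hkd n _] with n hn
    refine tsum_congr fun i => ?_
    by_cases hi : x i ω ∈ B
    · have := hn i hi
      simp only [this]
    · simp [hi]

end

/-! ### Measurability, and independence of the marks. -/

section

lemma measurable_receiver (d : ℝ) : Measurable fun p : Plane × ℝ => receiver d p.1 p.2 := by
  have : Continuous fun p : Plane × ℝ => receiver d p.1 p.2 := by
    unfold receiver
    refine continuous_fst.add ((PiLp.continuous_toLp 2 _).comp (continuous_pi fun i => ?_))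
    fin_cases i
    · simpa using (by fun_prop : Continuous fun p : Plane × ℝ => d * Real.cos p.2)
    · simpa using (by fun_prop : Continuous fun p : Plane × ℝ => d * Real.sin p.2)
  exact this.measurable

lemma measurableSet_mem_exclusionRegion {β : Type*} [MeasurableSpace β] (d Rcs Rtx : ℝ)
    {f g : β → Plane} {a : β → ℝ} (hf : Measurable f) (hg : Measurable g) (ha : Measurable a) :
    MeasurableSet {b | g b ∈ exclusionRegion d Rcs Rtx (f b) (a b)} := by
  simp only [mem_exclusionRegion_iff]
  have h := (measurable_receiver d).comp (hf.prodMk ha)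
  exact (measurableSet_le (hg.dist hf) measurable_const).union
    (measurableSet_le (hg.dist h) measurable_const)

lemma isCompact_exclusionRegion (d Rcs Rtx : ℝ) (y : Plane) (α : ℝ) :
    IsCompact (exclusionRegion d Rcs Rtx y α) :=
  (isCompact_closedBall _ _).union (isCompact_closedBall _ _)

variable {Ω : Type*} [MeasurableSpace Ω] {P : Measure Ω} {lam : ℝ≥0}
  {x : ℕ → Ω → Plane} {θ m : ℕ → Ω → ℝ}

lemma lintegral_indepFun {β γ : Type*} [MeasurableSpace β] [MeasurableSpace γ]
    [IsProbabilityMeasure P] {U : Ω → β} {V : Ω → γ} (hU : Measurable U) (hV : Measurable V)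
    (h : IndepFun U V P) {F : β × γ → ℝ≥0∞} (hF : Measurable F) :
    ∫⁻ ω, F (U ω, V ω) ∂P = ∫⁻ ω, ∫⁻ ω', F (U ω, V ω') ∂P ∂P := by
  have : IsProbabilityMeasure (P.map V) := Measure.isProbabilityMeasure_map hV.aemeasurable
  rw [← lintegral_map hF (hU.prodMk hV),
    (indepFun_iff_map_prod_eq_prod_map_map hU.aemeasurable hV.aemeasurable).1 h,
    lintegral_prod _ hF.aemeasurable, lintegral_map hF.lintegral_prod_right' hU]
  refine lintegral_congr fun ω => ?_
  exact lintegral_map (hF.comp measurable_prodMk_left) hV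

lemma measure_indepFun {β γ : Type*} [MeasurableSpace β] [MeasurableSpace γ]
    [IsProbabilityMeasure P] {U : Ω → β} {V : Ω → γ} (hU : Measurable U) (hV : Measurable V)
    (h : IndepFun U V P) {S : Set (β × γ)} (hS : MeasurableSet S) :
    P {ω | (U ω, V ω) ∈ S} = ∫⁻ ω, P {ω' | (U ω, V ω') ∈ S} ∂P := by
  have h1 := lintegral_indepFun hU hV h (measurable_one.indicator (f := fun _ => (1 : ℝ≥0∞)) hS)
  have h2 : MeasurableSet {ω | (U ω, V ω) ∈ S} := (hU.prodMk hV) hS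
  have h3 (ω : Ω) : MeasurableSet {ω' | (U ω, V ω') ∈ S} := (measurable_const.prodMk hV) hS
  rw [← lintegral_indicator_one h2]
  simp_rw [← lintegral_indicator_one (h3 _)]
  exact h1

lemma indepFun_compl {β : Type*} [MeasurableSpace β] {M : ℕ → Ω → β} (hM : ∀ i, Measurable (M i))
    (h : iIndepFun M P) (i : ℕ) : IndepFun (M i) (fun ω (j : {j // j ≠ i}) => M j ω) P := by
  have h1 := indep_iSup_of_disjoint (S := {i}) (T := {i}ᶜ) (fun j => (hM j).comap_le) h
    disjoint_compl_right
  refine indep_of_indep_of_le_right (indep_of_indep_of_le_left h1 ?_) ?_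
  · exact le_iSup₂_of_le i (mem_singleton i) le_rfl
  · rw [MeasurableSpace.pi, MeasurableSpace.comap_iSup]
    refine iSup_le fun j => ?_
    rw [MeasurableSpace.comap_comp]
    exact le_iSup₂_of_le (j : ℕ) j.2 le_rfl

namespace IsMarkedPoisson

lemma measurable_marks (h : IsMarkedPoisson P lam x θ m) : Measurable fun ω i => (θ i ω, m i ω) :=
  measurable_pi_lambda _ fun i => (h.measurable_θ i).prodMk (h.measurable_m i)

lemma measurable_locations (h : IsMarkedPoisson P lam x θ m) : Measurable fun ω i => x i ω :=
  measurable_pi_lambda _ h.measurable_x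

lemma indep_m (h : IsMarkedPoisson P lam x θ m) : iIndepFun m P :=
  h.indep_marks.comp (fun _ => Prod.snd) fun _ => measurable_snd

lemma hasLaw_mark [IsProbabilityMeasure P] (h : IsMarkedPoisson P lam x θ m) (i : ℕ) :
    HasLaw (fun ω => (θ i ω, m i ω))
    ((P.map (θ 0)).prod (volume.restrict (Icc (0 : ℝ) 1))) P := by
  refine ⟨((h.measurable_θ i).prodMk (h.measurable_m i)).aemeasurable, ?_⟩
  rw [(indepFun_iff_map_prod_eq_prod_map_map (h.measurable_θ i).aemeasurable
    (h.measurable_m i).aemeasurable).1 (h.indep_θ_m i), (h.θ_ident i 0).map_eq,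
    (h.m_uniform i).map_eq]

lemma measure_lt (h : IsMarkedPoisson P lam x θ m) {t : ℝ} (ht : t ∈ Icc (0 : ℝ) 1) (j : ℕ) :
    P (m j ⁻¹' Ioi t) = ENNReal.ofReal (1 - t) := by
  rw [← Measure.map_apply (h.measurable_m j) measurableSet_Ioi, (h.m_uniform j).map_eq,
    Measure.restrict_apply measurableSet_Ioi, ← Real.volume_Ioc]
  congr 1
  ext u
  simp only [mem_inter_iff, mem_Ioi, mem_Icc, mem_Ioc]
  exact ⟨fun hu => ⟨hu.1, hu.2.2⟩, fun hu => ⟨hu.1, ht.1.trans hu.1.le, hu.2⟩⟩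

/-- Independence gives the finite products, and continuity from above their infimum, so `J` may be
infinite. -/
lemma measure_forall_lt [IsProbabilityMeasure P] (h : IsMarkedPoisson P lam x θ m)
    {t : ℝ} (ht : t ∈ Icc (0 : ℝ) 1) (J : Set ℕ) :
    P {ω | ∀ j ∈ J, t < m j ω} = weight (ENNReal.ofReal (1 - t)) J := by
  classical
  set E : ℕ → Set ℝ := fun j => if j ∈ J then Ioi t else univ with hE
  have hEm (j : ℕ) : MeasurableSet (E j) := by
    simp only [hE]; split_ifs
    · exact measurableSet_Ioi
    · exact MeasurableSet.univ
  have hset : {ω | ∀ j ∈ J, t < m j ω} = ⋂ n : ℕ, ⋂ j ∈ Finset.range n, m j ⁻¹' E j := by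
    ext ω
    simp only [mem_ofPred_eq, mem_iInter, Finset.mem_range, mem_preimage, hE]
    constructor
    · intro H n j _
      by_cases hj : j ∈ J
      · simpa [hj] using H j hj
      · simp [hj]
    · intro H j hj
      simpa [hj] using H (j + 1) j (Nat.lt_succ_self j)
  have hanti : Antitone fun n : ℕ => ⋂ j ∈ Finset.range n, m j ⁻¹' E j := fun a b hab =>
    biInter_mono (fun j hj => Finset.mem_coe.2 (Finset.range_mono hab hj)) fun _ _ => subset_rfl
  rw [hset, hanti.measure_iInter (fun n => (Finset.measurableSet_biInter _ fun j _ =>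
    h.measurable_m j (hEm j)).nullMeasurableSet) ⟨0, measure_ne_top _ _⟩, weight]
  refine iInf_congr fun n => ?_
  rw [h.indep_m.measure_inter_preimage_eq_mul _ fun j _ => hEm j]
  refine Finset.prod_congr rfl fun j _ => ?_
  by_cases hj : j ∈ J
  · simp only [hE, hj, if_true]
    exact h.measure_lt ht j
  · simp [hE, hj]

lemma ae_m_mem (h : IsMarkedPoisson P lam x θ m) : ∀ᵐ ω ∂P, ∀ i, m i ω ∈ Icc (0 : ℝ) 1 := by
  refine ae_all_iff.2 fun i => ?_
  rw [(h.m_uniform i).ae_iff (p := fun t => t ∈ Icc (0 : ℝ) 1)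
    (measurableSet_setOfPred.1 measurableSet_Icc)]
  exact ae_restrict_mem measurableSet_Icc

end IsMarkedPoisson

end

/-! ### Retention probabilities. -/

section

variable {Ω : Type*} [MeasurableSpace Ω] {P : Measure Ω} {lam : ℝ≥0}
  {x : ℕ → Ω → Plane} {θ m : ℕ → Ω → ℝ} {d Rcs Rtx : ℝ}

/-- In the enumerated configuration with locations `ξ` and marks `μ`, the time mark of the `i`-th
node is smaller than the marks of all other nodes in its exclusion region. -/
def Wins (d Rcs Rtx : ℝ) (ξ : ℕ → Plane) (μ : ℕ → ℝ × ℝ) (i : ℕ) : Prop :=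
  ∀ j, j ≠ i → ξ j ∈ exclusionRegion d Rcs Rtx (ξ i) (μ i).1 → (μ i).2 < (μ j).2

lemma measurableSet_wins (d Rcs Rtx : ℝ) (i : ℕ) :
    MeasurableSet {p : (ℕ → Plane) × (ℕ → ℝ × ℝ) | Wins d Rcs Rtx p.1 p.2 i} := by
  have h1 (j : ℕ) : Measurable fun p : (ℕ → Plane) × (ℕ → ℝ × ℝ) => p.1 j :=
    (measurable_pi_apply j).comp measurable_fst
  have h2 (j : ℕ) : Measurable fun p : (ℕ → Plane) × (ℕ → ℝ × ℝ) => p.2 j :=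
    (measurable_pi_apply j).comp measurable_snd
  refine measurableSet_setOfPred.2 (Measurable.forall fun j => measurable_const.imp (.imp ?_ ?_))
  · exact measurableSet_setOfPred.1
      (measurableSet_mem_exclusionRegion d Rcs Rtx (h1 i) (h1 j) (h2 i).fst)
  · exact measurableSet_setOfPred.1 (measurableSet_lt (h2 i).snd (h2 j).snd)

namespace IsMarkedPoisson

/-- With the locations frozen, the marks of node `i` are independent of all the others; conditioning
on them fixes the exclusion region and the threshold. -/
lemma measure_wins [IsProbabilityMeasure P] (h : IsMarkedPoisson P lam x θ m) (ξ : ℕ → Plane)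
    (i : ℕ) {T : Set ℝ} (hT : MeasurableSet T) :
    P {ω | m i ω ∈ T ∧ Wins d Rcs Rtx ξ (fun j => (θ j ω, m j ω)) i} =
      ∫⁻ p, T.indicator 1 p.2 * weight (ENNReal.ofReal (1 - p.2))
        {j | j ≠ i ∧ ξ j ∈ exclusionRegion d Rcs Rtx (ξ i) p.1}
        ∂(P.map (θ 0)).prod (volume.restrict (Icc (0 : ℝ) 1)) := by
  have hM (j : ℕ) := (h.measurable_θ j).prodMk (h.measurable_m j)
  have hind := indepFun_compl hM h.indep_marks i
  have hV : Measurable fun ω (j : {j // j ≠ i}) => (θ j ω, m j ω) :=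
    measurable_pi_lambda _ fun j => hM j
  set S : Set ((ℝ × ℝ) × ({j // j ≠ i} → ℝ × ℝ)) :=
    {q | q.1.2 ∈ T ∧ ∀ j : {j // j ≠ i},
      ξ j ∈ exclusionRegion d Rcs Rtx (ξ i) q.1.1 → q.1.2 < (q.2 j).2} with hS
  have hSm : MeasurableSet S := by
    refine measurableSet_setOfPred.2 (.and ?_ (Measurable.forall fun j => .imp ?_ ?_))
    · exact measurableSet_setOfPred.1 ((measurable_snd.comp measurable_fst) hT)
    · exact measurableSet_setOfPred.1 (measurableSet_mem_exclusionRegion d Rcs Rtx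
        measurable_const measurable_const (by fun_prop))
    · exact measurableSet_setOfPred.1 (measurableSet_lt (by fun_prop) (by fun_prop))
  have hset : {ω | m i ω ∈ T ∧ Wins d Rcs Rtx ξ (fun j => (θ j ω, m j ω)) i} =
      {ω | ((θ i ω, m i ω), fun j : {j // j ≠ i} => (θ j ω, m j ω)) ∈ S} := by
    ext ω
    simp [hS, Wins]
  have hmeas : Measurable fun p : ℝ × ℝ => T.indicator (1 : ℝ → ℝ≥0∞) p.2 *
      weight (ENNReal.ofReal (1 - p.2))
        {j | j ≠ i ∧ ξ j ∈ exclusionRegion d Rcs Rtx (ξ i) p.1} := by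
    refine ((measurable_one.indicator hT).comp measurable_snd).mul
      (measurable_weight (by fun_prop) fun j => ?_)
    exact (MeasurableSet.const _).inter (measurableSet_mem_exclusionRegion d Rcs Rtx
      measurable_const measurable_const measurable_fst)
  rw [hset, measure_indepFun (hM i) hV hind hSm, ← (h.hasLaw_mark i).map_eq,
    lintegral_map hmeas (hM i)]
  refine lintegral_congr_ae ?_
  filter_upwards [h.ae_m_mem] with ω hω
  by_cases hωT : m i ω ∈ T
  · rw [indicator_of_mem hωT, Pi.one_apply, one_mul, ← h.measure_forall_lt (hω i)]
    congr 1
    ext ω'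
    simp only [hS, mem_ofPred_eq, hωT, true_and, Subtype.forall, and_imp]
  · simp [hS, hωT]

lemma lintegral_wins [IsProbabilityMeasure P] (h : IsMarkedPoisson P lam x θ m) (hd : 0 < d)
    (hR : 0 < Rcs) (hr : 0 < Rtx) {B : Set Plane} (hB : MeasurableSet B) (hB' : volume B < ∞)
    {T : Set ℝ} (hT : MeasurableSet T) (hT' : T ⊆ Icc 0 1) :
    ∑' i, P {ω | x i ω ∈ B ∧ m i ω ∈ T ∧
        Wins d Rcs Rtx (fun j => x j ω) (fun j => (θ j ω, m j ω)) i} =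
      lam * volume B * ∫⁻ t in T, ENNReal.ofReal (Real.exp (-lam * t * Vo d Rcs Rtx)) := by
  set κ := (P.map (θ 0)).prod (volume.restrict (Icc (0 : ℝ) 1)) with hκ
  have : IsProbabilityMeasure (P.map (θ 0)) :=
    Measure.isProbabilityMeasure_map (h.measurable_θ 0).aemeasurable
  have hstep (i : ℕ) : P {ω | x i ω ∈ B ∧ m i ω ∈ T ∧
        Wins d Rcs Rtx (fun j => x j ω) (fun j => (θ j ω, m j ω)) i} =
      ∫⁻ ω, ∫⁻ p, B.indicator 1 (x i ω) * (T.indicator 1 p.2 * weight (ENNReal.ofReal (1 - p.2))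
        {j | j ≠ i ∧ x j ω ∈ exclusionRegion d Rcs Rtx (x i ω) p.1}) ∂κ ∂P := by
    have hS : MeasurableSet {q : (ℕ → Plane) × (ℕ → ℝ × ℝ) |
        q.1 i ∈ B ∧ (q.2 i).2 ∈ T ∧ Wins d Rcs Rtx q.1 q.2 i} := by
      refine measurableSet_setOfPred.2 (.and ?_ (.and ?_ ?_))
      · exact measurableSet_setOfPred.1 (((measurable_pi_apply i).comp measurable_fst) hB)
      · exact measurableSet_setOfPred.1
          ((measurable_snd.comp ((measurable_pi_apply i).comp measurable_snd)) hT)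
      · exact measurableSet_setOfPred.1 (measurableSet_wins d Rcs Rtx i)
    have h1 := measure_indepFun h.measurable_locations h.measurable_marks h.indep_locations hS
    refine h1.trans (lintegral_congr fun ω => ?_)
    by_cases hω : x i ω ∈ B
    · simp only [hω, indicator_of_mem, Pi.one_apply, one_mul, mem_ofPred_eq, true_and]
      exact h.measure_wins (fun j => x j ω) i hT
    · simp [hω]
  have hmeas (i : ℕ) : Measurable fun q : Ω × ℝ × ℝ => B.indicator (1 : Plane → ℝ≥0∞) (x i q.1) *
      (T.indicator (1 : ℝ → ℝ≥0∞) q.2.2 * weight (ENNReal.ofReal (1 - q.2.2))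
        {j | j ≠ i ∧ x j q.1 ∈ exclusionRegion d Rcs Rtx (x i q.1) q.2.1}) := by
    have hx (j : ℕ) : Measurable fun q : Ω × ℝ × ℝ => x j q.1 :=
      (h.measurable_x j).comp measurable_fst
    refine ((measurable_one.indicator hB).comp (hx i)).mul
      (((measurable_one.indicator hT).comp (by fun_prop)).mul
        (measurable_weight (by fun_prop) fun j => ?_))
    exact (MeasurableSet.const _).inter
      (measurableSet_mem_exclusionRegion d Rcs Rtx (hx i) (hx j) (by fun_prop))
  calc
    _ = ∑' i, ∫⁻ p, ∫⁻ ω, B.indicator 1 (x i ω) * (T.indicator 1 p.2 *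
          weight (ENNReal.ofReal (1 - p.2))
          {j | j ≠ i ∧ x j ω ∈ exclusionRegion d Rcs Rtx (x i ω) p.1}) ∂P ∂κ := by
      refine tsum_congr fun i => ?_
      rw [hstep, lintegral_lintegral_swap (hmeas i).aemeasurable]
    _ = ∫⁻ p, ∫⁻ ω, ∑' i, B.indicator 1 (x i ω) * (T.indicator 1 p.2 *
          weight (ENNReal.ofReal (1 - p.2))
          {j | j ≠ i ∧ x j ω ∈ exclusionRegion d Rcs Rtx (x i ω) p.1}) ∂P ∂κ := by
      rw [← lintegral_tsum fun i => (hmeas i).lintegral_prod_left'.aemeasurable]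
      refine lintegral_congr fun p => ?_
      exact (lintegral_tsum fun i => ((hmeas i).comp measurable_prodMk_right).aemeasurable).symm
    _ = ∫⁻ p, T.indicator (fun t => lam * volume B *
          ENNReal.ofReal (Real.exp (-lam * t * Vo d Rcs Rtx))) p.2 ∂κ := by
      refine lintegral_congr fun p => ?_
      by_cases hp : p.2 ∈ T
      · have hp' := hT' hp
        have h0 : (0 : Plane) ∈ exclusionRegion d Rcs Rtx 0 p.1 :=
          Or.inl (Metric.mem_closedBall_self hR.le)
        -- For fixed orientation and mark the exclusion region is a translate of the one at the
        -- origin, so the Mecke formula applies with `s = 1 - p.2`.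
        have hm := mecke h.distinct h.measurable_x h.poisson
          (isCompact_exclusionRegion d Rcs Rtx 0 p.1) h0 hB hB'
          (s := 1 - p.2) (by linarith [hp'.2]) (by linarith [hp'.1])
        have htr (ω : Ω) (i j : ℕ) : x j ω - x i ω ∈ exclusionRegion d Rcs Rtx 0 p.1 ↔
            x j ω ∈ exclusionRegion d Rcs Rtx (x i ω) p.1 := by
          rw [← exclusionRegion_translate d Rcs Rtx (x i ω) (x i ω), sub_self]
        simp only [htr] at hm
        simp only [indicator_of_mem hp, Pi.one_apply, one_mul]
        rw [hm, volume_exclusionRegion hd hR hr, ENNReal.toReal_ofReal (Vo_pos hd hR hr).le]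
        congr 3
        ring
      · simp [hp]
    _ = _ := by
      have hg : Measurable fun t : ℝ => lam * volume B *
          ENNReal.ofReal (Real.exp (-lam * t * Vo d Rcs Rtx)) := by fun_prop
      -- The integrand no longer involves the orientation, whose law integrates to `1`.
      have hprod := lintegral_prod (μ := P.map (θ 0)) (ν := volume.restrict (Icc (0 : ℝ) 1)) _
        ((hg.indicator hT).comp measurable_snd).aemeasurable
      refine hprod.trans ?_
      simp only [Function.comp_apply, lintegral_const, measure_univ, mul_one]
      rw [lintegral_indicator hT, Measure.restrict_restrict hT, inter_eq_self_of_subset_left hT',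
        lintegral_const_mul _ (by fun_prop)]

lemma tsum_measure_mark [IsProbabilityMeasure P] (h : IsMarkedPoisson P lam x θ m)
    {B : Set Plane} (hB : MeasurableSet B) (hB' : volume B < ∞) {T : Set ℝ}
    (hT : MeasurableSet T) (hT' : T ⊆ Icc 0 1) :
    ∑' i, P {ω | x i ω ∈ B ∧ m i ω ∈ T} = lam * volume B * volume T := by
  have hstep (i : ℕ) : P {ω | x i ω ∈ B ∧ m i ω ∈ T} =
      (∫⁻ ω, B.indicator 1 (x i ω) ∂P) * volume T := by
    have hind : IndepFun (x i) (m i) P :=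
      h.indep_locations.comp (φ := fun ξ : ℕ → Plane => ξ i) (ψ := fun μ : ℕ → ℝ × ℝ => (μ i).2)
        (measurable_pi_apply i) (measurable_snd.comp (measurable_pi_apply i))
    have h1 := hind.measure_inter_preimage_eq_mul B T hB hT
    rw [← Measure.map_apply (h.measurable_m i) hT, (h.m_uniform i).map_eq,
      Measure.restrict_apply hT, inter_eq_self_of_subset_left hT',
      ← lintegral_indicator_one (h.measurable_x i hB)] at h1
    exact h1
  simp_rw [hstep]
  have hsum := lintegral_tsum (μ := P) fun i =>
    ((measurable_one (α := ℝ≥0∞).indicator hB).comp (h.measurable_x i)).aemeasurable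
  rw [ENNReal.tsum_mul_right, ← lintegral_tsum_indicator h.distinct h.poisson hB hB']
  exact congrArg (· * volume T) hsum.symm

/-- The added location is deterministic, so the generating function of the count in one fixed region
suffices. -/
lemma measure_added_wins [IsProbabilityMeasure P] (h : IsMarkedPoisson P lam x θ m) (hd : 0 < d)
    (hR : 0 < Rcs) (hr : 0 < Rtx) (y : Plane) (α : ℝ) {t : ℝ} (ht : t ∈ Icc (0 : ℝ) 1) :
    P {ω | ∀ j, x j ω ∈ exclusionRegion d Rcs Rtx y α → t < m j ω} =
      ENNReal.ofReal (Real.exp (-lam * t * Vo d Rcs Rtx)) := by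
  have hc := isCompact_exclusionRegion d Rcs Rtx y α
  have hS : MeasurableSet {q : (ℕ → Plane) × (ℕ → ℝ × ℝ) |
      ∀ j, q.1 j ∈ exclusionRegion d Rcs Rtx y α → t < (q.2 j).2} := by
    refine measurableSet_setOfPred.2 (Measurable.forall fun j => .imp ?_ ?_)
    · exact measurableSet_setOfPred.1
        (((measurable_pi_apply j).comp measurable_fst) hc.isClosed.measurableSet)
    · exact measurableSet_setOfPred.1 (measurableSet_lt measurable_const
        (measurable_snd.comp ((measurable_pi_apply j).comp measurable_snd)))
  have h1 := measure_indepFun h.measurable_locations h.measurable_marks h.indep_locations hS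
  refine h1.trans ?_
  have h2 := h.poisson.lintegral_pow hc.isClosed.measurableSet hc.measure_lt_top
    (s := 1 - t) (by linarith [ht.2])
  rw [volume_exclusionRegion hd hR hr, ENNReal.toReal_ofReal (Vo_pos hd hR hr).le] at h2
  rw [show -(lam : ℝ) * t * Vo d Rcs Rtx = -(lam * Vo d Rcs Rtx * (1 - (1 - t))) by ring, ← h2]
  refine lintegral_congr_ae ?_
  filter_upwards [h.distinct, h.poisson.ae_finite hc.isClosed.measurableSet hc.measure_lt_top]
    with ω hω hfin
  have h3 := h.measure_forall_lt ht {j | x j ω ∈ exclusionRegion d Rcs Rtx y α}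
  refine h3.trans ?_
  rw [← image_preimage_eq_range_inter] at hfin ⊢
  change weight _ ((fun i => x i ω) ⁻¹' _) = _
  rw [hω.encard_image, weight_of_finite (ENNReal.ofReal_le_one.2 (by linarith [ht.1]))
    (hfin.of_finite_image hω.injOn)]
  rfl

end IsMarkedPoisson

end

/-! ### Retention and recentring for enumerated configurations. -/

section

section Configurations

variable {d Rcs Rtx : ℝ} {ξ : ℕ → Plane} {μ : ℕ → ℝ × ℝ}

/-- The marked configuration with locations `ξ` and marks `μ`. -/
def nodes (ξ : ℕ → Plane) (μ : ℕ → ℝ × ℝ) : Set Node := range fun i => ((ξ i, μ i) : Node)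

lemma retained_nodes_iff (hξ : Function.Injective ξ) (i : ℕ) :
    Retained d Rcs Rtx (nodes ξ μ) (ξ i, μ i) ↔ Wins d Rcs Rtx ξ μ i := by
  constructor
  · rintro ⟨-, H⟩ j hji hj
    exact H (ξ j, μ j) ⟨⟨j, rfl⟩, hj, fun h => hji (hξ (Prod.ext_iff.1 h).1)⟩
  · refine fun H => ⟨⟨i, rfl⟩, ?_⟩
    rintro - ⟨⟨j, rfl⟩, hj, hne⟩
    exact H j (fun h => hne (by rw [h])) hj

lemma activeTransmitters_nodes (hξ : Function.Injective ξ) :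
    activeTransmitters d Rcs Rtx (nodes ξ μ) = ξ '' {i | Wins d Rcs Rtx ξ μ i} := by
  ext z
  constructor
  · rintro ⟨-, ⟨p, hp, rfl⟩, rfl⟩
    obtain ⟨i, rfl⟩ := hp.1
    exact ⟨i, (retained_nodes_iff hξ i).1 hp, rfl⟩
  · rintro ⟨i, hi, rfl⟩
    exact ⟨_, ⟨_, (retained_nodes_iff hξ i).2 hi, rfl⟩, rfl⟩

lemma encard_activeTransmitters_inter (hξ : Function.Injective ξ) (B : Set Plane) :
    (activeTransmitters d Rcs Rtx (nodes ξ μ) ∩ B).encard =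
      {i | ξ i ∈ B ∧ Wins d Rcs Rtx ξ μ i}.encard := by
  rw [activeTransmitters_nodes hξ, ← image_inter_preimage, hξ.encard_image]
  congr 1
  ext i
  exact and_comm

lemma recentre_nodes (y : Plane) : recentre y (nodes ξ μ) = nodes (fun j => ξ j - y) μ := by
  rw [recentre, nodes, ← range_comp]
  rfl

lemma wins_translate (y : Plane) (i : ℕ) :
    Wins d Rcs Rtx (fun j => ξ j - y) μ i ↔ Wins d Rcs Rtx ξ μ i := by
  simp only [Wins, exclusionRegion_translate]

/-- By injectivity, node `i` is the only one that recentring moves to the origin, and `Wins` is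
translation invariant. -/
lemma recentre_mem_originActive_iff (hξ : Function.Injective ξ) (i : ℕ) :
    recentre (ξ i) (nodes ξ μ) ∈ originActive d Rcs Rtx ↔ Wins d Rcs Rtx ξ μ i := by
  have hξ' : Function.Injective fun j => ξ j - ξ i := fun a b hab => hξ (sub_left_injective hab)
  change (0 : Plane) ∈ activeTransmitters d Rcs Rtx (recentre (ξ i) (nodes ξ μ)) ↔ _
  rw [recentre_nodes, activeTransmitters_nodes hξ']
  constructor
  · rintro ⟨j, hj, h0⟩
    obtain rfl : j = i := hξ (sub_eq_zero.1 h0)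
    exact (wins_translate _ _).1 hj
  · exact fun h => ⟨i, (wins_translate _ _).2 h, sub_self _⟩

lemma recentre_mem_originMark_iff (hξ : Function.Injective ξ) (i : ℕ) (T : Set ℝ) :
    recentre (ξ i) (nodes ξ μ) ∈ originMark T ↔ (μ i).2 ∈ T := by
  rw [recentre_nodes]
  constructor
  · rintro ⟨-, ⟨j, rfl⟩, h0, hT⟩
    obtain rfl : j = i := hξ (sub_eq_zero.1 h0)
    exact hT
  · exact fun h => ⟨_, ⟨i, rfl⟩, sub_self _, h⟩

lemma encard_recentre (hξ : Function.Injective ξ) (B : Set Plane) (Y : Set (Set Node)) :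
    {p | p ∈ nodes ξ μ ∧ p.1 ∈ B ∧ recentre p.1 (nodes ξ μ) ∈ Y}.encard =
      {i | ξ i ∈ B ∧ recentre (ξ i) (nodes ξ μ) ∈ Y}.encard := by
  have hinj : Function.Injective fun i => ((ξ i, μ i) : Node) :=
    fun a b hab => hξ (Prod.ext_iff.1 hab).1
  rw [← hinj.encard_image]
  congr 1
  ext p
  constructor
  · rintro ⟨⟨i, rfl⟩, h⟩
    exact ⟨i, h, rfl⟩
  · rintro ⟨i, h, rfl⟩
    exact ⟨⟨i, rfl⟩, h⟩

end Configurations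

/-! ### Intensity and Palm probabilities. -/

lemma config_eq_nodes {Ω : Type*} {x : ℕ → Ω → Plane} {θ m : ℕ → Ω → ℝ} (ω : Ω) :
    config x θ m ω = nodes (fun i => x i ω) (fun i => (θ i ω, m i ω)) := rfl

lemma encard_eq_tsum_indicator {α : Type*} (S : ℕ → Set α) (a : α) :
    ({i | a ∈ S i}.encard : ℝ≥0∞) = ∑' i, (S i).indicator 1 a := by
  rw [← ENNReal.tsum_set_one, tsum_subtype {i | a ∈ S i} (fun _ => (1 : ℝ≥0∞))]
  rfl

variable {Ω : Type*} [MeasurableSpace Ω] {P : Measure Ω} {lam : ℝ≥0}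
  {x : ℕ → Ω → Plane} {θ m : ℕ → Ω → ℝ} {d Rcs Rtx : ℝ}

lemma measurable_encard {S : ℕ → Set Ω} (hS : ∀ i, MeasurableSet (S i)) :
    Measurable fun ω => ({i | ω ∈ S i}.encard : ℝ≥0∞) := by
  simp_rw [encard_eq_tsum_indicator]
  exact Measurable.tsum fun i => measurable_one.indicator (hS i)

lemma lintegral_encard {S : ℕ → Set Ω} (hS : ∀ i, MeasurableSet (S i)) :
    ∫⁻ ω, ({i | ω ∈ S i}.encard : ℝ≥0∞) ∂P = ∑' i, P (S i) := by
  simp_rw [encard_eq_tsum_indicator]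
  rw [lintegral_tsum fun i => (measurable_one.indicator (hS i)).aemeasurable]
  simp_rw [lintegral_indicator_one (hS _)]

lemma integral_exp_mark (lam : ℝ≥0) (hlam : 0 < lam) {V : ℝ} (hV : 0 < V) :
    lam * ∫ t in (0 : ℝ)..1, Real.exp (-lam * t * V) = (1 - Real.exp (-lam * V)) / V := by
  have hl : (0 : ℝ) < lam := hlam
  have hder (t : ℝ) : HasDerivAt (fun u => -Real.exp (-lam * u * V) / (lam * V))
      (Real.exp (-lam * t * V)) t := by
    have h1 : HasDerivAt (fun u : ℝ => -lam * u * V) (-lam * V) t := by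
      simpa using ((hasDerivAt_id t).const_mul (-(lam : ℝ))).mul_const V
    refine (h1.exp.neg.div_const (lam * V)).congr_deriv ?_
    field_simp
  rw [intervalIntegral.integral_eq_sub_of_hasDerivAt (fun t _ => hder t)
    (Continuous.intervalIntegrable (by fun_prop) _ _)]
  simp only [mul_one, mul_zero, zero_mul, Real.exp_zero]
  field_simp
  ring

lemma lintegral_exp_mark (lam : ℝ≥0) (hlam : 0 < lam) {V : ℝ} (hV : 0 < V) :
    lam * ∫⁻ t in Icc (0 : ℝ) 1, ENNReal.ofReal (Real.exp (-lam * t * V)) =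
      ENNReal.ofReal ((1 - Real.exp (-lam * V)) / V) := by
  have hc : Continuous fun t : ℝ => Real.exp (-lam * t * V) := by fun_prop
  rw [← integral_exp_mark lam hlam hV, ENNReal.ofReal_mul (NNReal.coe_nonneg lam),
    ENNReal.ofReal_coe_nnreal,
    intervalIntegral.integral_of_le zero_le_one, ← integral_Icc_eq_integral_Ioc,
    ofReal_integral_eq_lintegral_ofReal hc.integrableOn_Icc
      (Eventually.of_forall fun t => (Real.exp_pos _).le)]

namespace IsMarkedPoisson

lemma measurableSet_wins_inter (h : IsMarkedPoisson P lam x θ m) {B : Set Plane}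
    (hB : MeasurableSet B) (i : ℕ) : MeasurableSet {ω | x i ω ∈ B ∧
      Wins d Rcs Rtx (fun j => x j ω) (fun j => (θ j ω, m j ω)) i} :=
  (h.measurable_x i hB).inter
    ((h.measurable_locations.prodMk h.measurable_marks) (measurableSet_wins d Rcs Rtx i))

lemma tsum_measure_wins [IsProbabilityMeasure P] (h : IsMarkedPoisson P lam x θ m)
    (hlam : 0 < lam) (hd : 0 < d) (hR : 0 < Rcs) (hr : 0 < Rtx) {B : Set Plane}
    (hB : MeasurableSet B) :
    ∑' i, P {ω | x i ω ∈ B ∧ Wins d Rcs Rtx (fun j => x j ω) (fun j => (θ j ω, m j ω)) i} =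
      ENNReal.ofReal ((1 - Real.exp (-lam * Vo d Rcs Rtx)) / Vo d Rcs Rtx) * volume B := by
  set c := ENNReal.ofReal ((1 - Real.exp (-lam * Vo d Rcs Rtx)) / Vo d Rcs Rtx) with hc
  -- The mean number of retained nodes as a measure on the plane. It equals `c • volume` on sets of
  -- finite area, hence on all Borel sets by σ-finiteness of the area.
  set ν : Measure Plane := Measure.sum fun i => (P.restrict
    {ω | Wins d Rcs Rtx (fun j => x j ω) (fun j => (θ j ω, m j ω)) i}).map (x i) with hν
  have hνB {S : Set Plane} (hS : MeasurableSet S) : ν S = ∑' i, P {ω | x i ω ∈ S ∧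
      Wins d Rcs Rtx (fun j => x j ω) (fun j => (θ j ω, m j ω)) i} := by
    rw [hν, Measure.sum_apply _ hS]
    refine tsum_congr fun i => ?_
    rw [Measure.map_apply (h.measurable_x i) hS, Measure.restrict_apply (h.measurable_x i hS)]
    rfl
  have hfin {S : Set Plane} (hS : MeasurableSet S) (hS' : volume S < ∞) :
      ν S = c * volume S := by
    rw [hνB hS, hc, ← lintegral_exp_mark lam hlam (Vo_pos hd hR hr), mul_right_comm,
      ← h.lintegral_wins hd hR hr hS hS' measurableSet_Icc subset_rfl]
    refine tsum_congr fun i => measure_congr ?_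
    filter_upwards [h.ae_m_mem] with ω hω
    have := hω i
    exact propext ⟨fun H => ⟨H.1, this, H.2⟩, fun H => ⟨H.1, H.2.2⟩⟩
  have hext : ν = c • volume := by
    refine Measure.ext_of_iUnion_eq_univ (iUnion_spanningSets (volume : Measure Plane))
      fun n => ?_
    ext S hS
    rw [Measure.restrict_apply hS, Measure.restrict_apply hS, Measure.smul_apply, smul_eq_mul]
    exact hfin (hS.inter (measurableSet_spanningSets _ n))
      ((measure_mono inter_subset_right).trans_lt (measure_spanningSets_lt_top _ n))
  rw [← hνB hB, hext, Measure.smul_apply, smul_eq_mul]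

lemma hasIntensity_activeTransmitters [IsProbabilityMeasure P]
    (h : IsMarkedPoisson P lam x θ m) (hlam : 0 < lam) (hd : 0 < d) (hR : 0 < Rcs)
    (hr : 0 < Rtx) :
    HasIntensity P (fun ω => activeTransmitters d Rcs Rtx (config x θ m ω))
      ((1 - Real.exp (-lam * Vo d Rcs Rtx)) / Vo d Rcs Rtx) := by
  have hV := Vo_pos hd hR hr
  refine ⟨div_nonneg (sub_nonneg.2 (Real.exp_le_one_iff.2 ?_)) hV.le, fun B hB => ?_⟩
  · rw [neg_mul]
    exact neg_nonpos.2 (mul_nonneg lam.2 hV.le)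
  have hS := h.measurableSet_wins_inter (d := d) (Rcs := Rcs) (Rtx := Rtx) hB
  have hae : (fun ω => ((activeTransmitters d Rcs Rtx (config x θ m ω) ∩ B).encard : ℝ≥0∞))
      =ᵐ[P] fun ω => ({i | ω ∈ {ω | x i ω ∈ B ∧
        Wins d Rcs Rtx (fun j => x j ω) (fun j => (θ j ω, m j ω)) i}}.encard : ℝ≥0∞) := by
    filter_upwards [h.distinct] with ω hω
    rw [config_eq_nodes, encard_activeTransmitters_inter hω]
  refine ⟨(measurable_encard hS).aemeasurable.congr hae.symm, ?_⟩
  rw [lintegral_congr_ae hae, lintegral_encard hS]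
  exact h.tsum_measure_wins hlam hd hR hr hB

/-- Turns a Palm probability into a sum over indices. The events `S i` need to describe `Y` only for
injective enumerations, which is almost every `ω`. -/
lemma palmProb_eq (h : IsMarkedPoisson P lam x θ m) (B : Set Plane) (Y : Set (Set Node))
    {S : ℕ → Set Ω} (hS : ∀ i, MeasurableSet (S i))
    (hY : ∀ ω, Function.Injective (fun i => x i ω) → ∀ i,
      (x i ω ∈ B ∧ recentre (x i ω) (config x θ m ω) ∈ Y ↔ ω ∈ S i)) :
    palmProb P lam (config x θ m) B Y = (∑' i, P (S i)) / (lam * volume B) := by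
  rw [palmProb, ← lintegral_encard hS]
  congr 1
  refine lintegral_congr_ae ?_
  filter_upwards [h.distinct] with ω hω
  have := encard_recentre (μ := fun i => (θ i ω, m i ω)) hω B Y
  simp only [config_eq_nodes] at hY ⊢
  rw [this]
  simp only [hY ω hω]

lemma palmProb_originActive [IsProbabilityMeasure P] (h : IsMarkedPoisson P lam x θ m)
    (hlam : 0 < lam) (hd : 0 < d) (hR : 0 < Rcs) (hr : 0 < Rtx) {B : Set Plane}
    (hB : MeasurableSet B) (hB0 : 0 < volume B) (hB' : volume B < ∞) :
    ENNReal.ofReal ((1 - Real.exp (-lam * Vo d Rcs Rtx)) / Vo d Rcs Rtx) =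
      lam * palmProb P lam (config x θ m) B (originActive d Rcs Rtx) := by
  rw [h.palmProb_eq B _ (h.measurableSet_wins_inter (d := d) (Rcs := Rcs) (Rtx := Rtx) hB)
    fun ω hω i => and_congr_right fun _ =>
      recentre_mem_originActive_iff (μ := fun i => (θ i ω, m i ω)) hω i,
    h.tsum_measure_wins hlam hd hR hr hB, mul_comm (lam : ℝ≥0∞) (volume B), ← mul_div_assoc,
    mul_comm (lam : ℝ≥0∞), mul_assoc, ENNReal.mul_div_cancel_right
      (mul_ne_zero hB0.ne' (ENNReal.coe_ne_zero.2 hlam.ne'))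
      (ENNReal.mul_ne_top hB'.ne ENNReal.coe_ne_top)]

lemma palmProb_originMark [IsProbabilityMeasure P] (h : IsMarkedPoisson P lam x θ m)
    (hlam : 0 < lam) {B : Set Plane}
    (hB : MeasurableSet B) (hB0 : 0 < volume B) (hB' : volume B < ∞) {T : Set ℝ}
    (hT : MeasurableSet T) (hT' : T ⊆ Icc 0 1) :
    palmProb P lam (config x θ m) B (originMark T) = volume T := by
  have hl : (lam : ℝ≥0∞) * volume B ≠ 0 :=
    mul_ne_zero (ENNReal.coe_ne_zero.2 hlam.ne') hB0.ne'
  rw [h.palmProb_eq B _ (S := fun i => {ω | x i ω ∈ B ∧ m i ω ∈ T})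
    (fun i => (h.measurable_x i hB).inter (h.measurable_m i hT))
    fun ω hω i => and_congr_right fun _ =>
      recentre_mem_originMark_iff (μ := fun i => (θ i ω, m i ω)) hω i T,
    h.tsum_measure_mark hB hB' hT hT',
    mul_comm, ENNReal.mul_div_cancel_right hl (ENNReal.mul_ne_top ENNReal.coe_ne_top hB'.ne)]

lemma palmProb_originActive_inter_originMark [IsProbabilityMeasure P]
    (h : IsMarkedPoisson P lam x θ m) (hlam : 0 < lam) (hd : 0 < d) (hR : 0 < Rcs)
    (hr : 0 < Rtx) {B : Set Plane} (hB : MeasurableSet B) (hB0 : 0 < volume B)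
    (hB' : volume B < ∞) {T : Set ℝ} (hT : MeasurableSet T) (hT' : T ⊆ Icc 0 1) :
    palmProb P lam (config x θ m) B (originActive d Rcs Rtx ∩ originMark T) =
      ∫⁻ t in T, ENNReal.ofReal (Real.exp (-lam * t * Vo d Rcs Rtx)) := by
  have hl : (lam : ℝ≥0∞) * volume B ≠ 0 :=
    mul_ne_zero (ENNReal.coe_ne_zero.2 hlam.ne') hB0.ne'
  have hS (i : ℕ) : MeasurableSet {ω | x i ω ∈ B ∧ m i ω ∈ T ∧
      Wins d Rcs Rtx (fun j => x j ω) (fun j => (θ j ω, m j ω)) i} :=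
    (h.measurable_x i hB).inter ((h.measurable_m i hT).inter
      ((h.measurable_locations.prodMk h.measurable_marks) (measurableSet_wins d Rcs Rtx i)))
  rw [h.palmProb_eq B _ hS fun ω hω i => and_congr_right fun _ => and_comm.trans (and_congr
      (recentre_mem_originMark_iff (μ := fun i => (θ i ω, m i ω)) hω i T)
      (recentre_mem_originActive_iff (μ := fun i => (θ i ω, m i ω)) hω i)),
    h.lintegral_wins hd hR hr hB hB' hT hT',
    mul_comm, ENNReal.mul_div_cancel_right hl (ENNReal.mul_ne_top ENNReal.coe_ne_top hB'.ne)]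

lemma measure_retained_insert [IsProbabilityMeasure P] (h : IsMarkedPoisson P lam x θ m)
    (hd : 0 < d) (hR : 0 < Rcs) (hr : 0 < Rtx) (y : Plane) (α : ℝ) {t : ℝ}
    (ht : t ∈ Icc (0 : ℝ) 1) :
    P {ω | Retained d Rcs Rtx (insert (y, α, t) (config x θ m ω)) (y, α, t)} =
      ENNReal.ofReal (Real.exp (-lam * t * Vo d Rcs Rtx)) := by
  rw [← h.measure_added_wins hd hR hr y α ht]
  refine measure_congr ?_
  -- A singleton has area `0`, so almost surely no node sits at `y`. Hence no node of the process
  -- can coincide with the added one and drop out of its neighbours.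
  have hne : ∀ᵐ ω ∂P, ∀ i, x i ω ≠ y := by
    have h0 := h.tsum_measure_mark (measurableSet_singleton y) (by simp) measurableSet_Icc
      subset_rfl
    simp only [measure_singleton, mul_zero, zero_mul, ENNReal.tsum_eq_zero] at h0
    refine ae_all_iff.2 fun i => ?_
    have hi : ∀ᵐ ω ∂P, ¬ (x i ω ∈ ({y} : Set Plane) ∧ m i ω ∈ Icc (0 : ℝ) 1) := by
      rw [ae_iff]
      simpa only [not_not] using h0 i
    filter_upwards [hi, h.ae_m_mem] with ω h1 h2 h3
    exact h1 ⟨h3, h2 i⟩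
  filter_upwards [hne] with ω hω
  refine propext ⟨fun H j hj => ?_, fun H => ⟨mem_insert _ _, ?_⟩⟩
  · exact H.2 (x j ω, θ j ω, m j ω) ⟨Or.inr ⟨j, rfl⟩, hj, fun h => hω j (Prod.ext_iff.1 h).1⟩
  · rintro q ⟨hq | ⟨j, rfl⟩, hqD, hqne⟩
    · exact absurd hq hqne
    · exact H j hqD

end IsMarkedPoisson

end

end DZHCP

end

theorem mainTheorem4 {Ω : Type*} [MeasurableSpace Ω] (P : Measure Ω) [IsProbabilityMeasure P]
    (lam : ℝ≥0) (hlam : 0 < lam) (d Rcs Rtx : ℝ) (hd : 0 < d) (hRtx : 0 < Rtx) (hR : Rtx < Rcs)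
    (x : ℕ → Ω → DZHCP.Plane) (θ : ℕ → Ω → ℝ) (m : ℕ → Ω → ℝ)
    (hΨ : DZHCP.IsMarkedPoisson P lam x θ m) :
    -- `V_o` is the (positive) area of every exclusion region
    (0 < DZHCP.Vo d Rcs Rtx ∧ ∀ (y : DZHCP.Plane) (α : ℝ),
      volume (DZHCP.exclusionRegion d Rcs Rtx y α) = ENNReal.ofReal (DZHCP.Vo d Rcs Rtx)) ∧
    -- the intensity of the process of active transmitters
    DZHCP.HasIntensity P
      (fun ω => DZHCP.activeTransmitters d Rcs Rtx (DZHCP.config x θ m ω))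
      ((1 - Real.exp (-lam * DZHCP.Vo d Rcs Rtx)) / DZHCP.Vo d Rcs Rtx) ∧
    -- it is `lam` times the Palm probability that the origin is active
    (∀ B : Set DZHCP.Plane, MeasurableSet B → 0 < volume B → volume B < ∞ →
      ENNReal.ofReal ((1 - Real.exp (-lam * DZHCP.Vo d Rcs Rtx)) / DZHCP.Vo d Rcs Rtx) =
        lam * DZHCP.palmProb P lam (DZHCP.config x θ m) B (DZHCP.originActive d Rcs Rtx)) ∧
    -- under the Palm probability the mark of the origin is uniform on `[0, 1]`, and given that the
    -- mark is `t` the origin is active with conditional probability `exp (-lam * t * V_o)`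
    (∀ B : Set DZHCP.Plane, MeasurableSet B → 0 < volume B → volume B < ∞ →
      ∀ T : Set ℝ, MeasurableSet T → T ⊆ Icc 0 1 →
        DZHCP.palmProb P lam (DZHCP.config x θ m) B (DZHCP.originMark T) = volume T ∧
        DZHCP.palmProb P lam (DZHCP.config x θ m) B
            (DZHCP.originActive d Rcs Rtx ∩ DZHCP.originMark T) =
          ∫⁻ t in T, ENNReal.ofReal (Real.exp (-lam * t * DZHCP.Vo d Rcs Rtx))) ∧
    -- a given pair with time mark `t`, added to the process, is retained with that probability
    (∀ (y : DZHCP.Plane) (α t : ℝ), t ∈ Icc (0 : ℝ) 1 →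
      P {ω | DZHCP.Retained d Rcs Rtx (insert (y, α, t) (DZHCP.config x θ m ω)) (y, α, t)} =
        ENNReal.ofReal (Real.exp (-lam * t * DZHCP.Vo d Rcs Rtx))) ∧
    -- integration over a uniform time mark gives the closed form
    lam * ∫ t in (0 : ℝ)..1, Real.exp (-lam * t * DZHCP.Vo d Rcs Rtx) =
      (1 - Real.exp (-lam * DZHCP.Vo d Rcs Rtx)) / DZHCP.Vo d Rcs Rtx := by
  have hRcs : 0 < Rcs := hRtx.trans hR
  have hV := DZHCP.Vo_pos hd hRcs hRtx
  exact ⟨⟨hV, DZHCP.volume_exclusionRegion hd hRcs hRtx⟩,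
    hΨ.hasIntensity_activeTransmitters hlam hd hRcs hRtx,
    fun _ hB hB0 hB' => hΨ.palmProb_originActive hlam hd hRcs hRtx hB hB0 hB',
    fun _ hB hB0 hB' _ hT hT' => ⟨hΨ.palmProb_originMark hlam hB hB0 hB' hT hT',
      hΨ.palmProb_originActive_inter_originMark hlam hd hRcs hRtx hB hB0 hB' hT hT'⟩,
    fun y α _ ht => hΨ.measure_retained_insert hd hRcs hRtx y α ht,
    DZHCP.integral_exp_mark lam hlam hV⟩
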